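/- **Theorem 3.** Let $A=\{a_1,\dots,a_s\}$ and $B=\{b_1,\dots,b_t\}$ be finite sets with $|A|+|B|=s+t=n$. Let every pair $(a_i,b_j)$ have a real cost $c(a_i,b_j)\ge 0$ and every object $v\in A\cup B$ a capacity $\mathrm{cap}(v)\in\mathbb{N}$. A *limited-capacity assignment* is a set $M\subseteq A\times B$ such that every object $v\in A\cup B$ occurs in at least $1$ and at most $\mathrm{cap}(v)$ pairs of $M$; its cost is $\sum_{(a,b)\in M}c(a,b)$. A limited-capacity assignment of minimum cost can be computed in $O(n^3)$ time. That is, there is a single program for a real random access machine (exact real numbers, with addition, subtraction and comparison of reals as unit-cost operations, and unit-cost addition, truncated subtraction, comparison and addressing on natural numbers) and a constant $C$ such that on every instance the program halts after at most $C(n^3+1)$ steps; it outputs a limited-capacity assignment of minimum cost if the instance has a limited-capacity assignment, and reports that there is none otherwise. -/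

import Mathlib

/-! A real random access machine, given by its structured programs.  The memory consists of
scalar registers and unbounded arrays, holding natural numbers (counters, addresses, flags) or
real numbers (exact).  On naturals the machine can add, subtract (truncated), compare and use
a value as an address; on reals it can only add, subtract and compare.  There is no
multiplication and no conversion between reals and naturals.  Time is measured with uniform
cost: every operation, memory access, constant, test and command takes one step. -/
namespace RealRAM

/-- A memory state: natural and real registers, and natural and real arrays (the first argument
of `iarr` and `rarr` is the name of the array, the second one is the position in it).  A program
is a finite object and mentions finitely many names. -/
structure State where
  ivar : ℕ → ℕ
  rvar : ℕ → ℝ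
  iarr : ℕ → ℕ → ℕ
  rarr : ℕ → ℕ → ℝ

/-- Expressions with values in the natural numbers. -/
inductive IExp where
  | const (k : ℕ)
  | var (x : ℕ)
  | get (a : ℕ) (e : IExp)
  | add (e₁ e₂ : IExp)
  | sub (e₁ e₂ : IExp)

/-- Expressions with values in the real numbers. -/
inductive RExp where
  | zero
  | var (x : ℕ)
  | get (a : ℕ) (e : IExp)
  | add (e₁ e₂ : RExp)
  | sub (e₁ e₂ : RExp)

/-- Tests. -/
inductive BExp where
  | ile (e₁ e₂ : IExp)
  | rle (e₁ e₂ : RExp)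
  | not (b : BExp)
  | and (b₁ b₂ : BExp)

def IExp.eval (σ : State) : IExp → ℕ
  | .const k => k
  | .var x => σ.ivar x
  | .get a e => σ.iarr a (e.eval σ)
  | .add e₁ e₂ => e₁.eval σ + e₂.eval σ
  | .sub e₁ e₂ => e₁.eval σ - e₂.eval σ

/-- The number of steps needed to evaluate the expression. -/
def IExp.cost : IExp → ℕ
  | .const _ => 1
  | .var _ => 1
  | .get _ e => e.cost + 1
  | .add e₁ e₂ => e₁.cost + e₂.cost + 1
  | .sub e₁ e₂ => e₁.cost + e₂.cost + 1

noncomputable def RExp.eval (σ : State) : RExp → ℝ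
  | .zero => 0
  | .var x => σ.rvar x
  | .get a e => σ.rarr a (e.eval σ)
  | .add e₁ e₂ => e₁.eval σ + e₂.eval σ
  | .sub e₁ e₂ => e₁.eval σ - e₂.eval σ

/-- The number of steps needed to evaluate the expression. -/
def RExp.cost : RExp → ℕ
  | .zero => 1
  | .var _ => 1
  | .get _ e => e.cost + 1
  | .add e₁ e₂ => e₁.cost + e₂.cost + 1
  | .sub e₁ e₂ => e₁.cost + e₂.cost + 1

/-- The test `b` succeeds in the state `σ`. -/
def BExp.Holds (σ : State) : BExp → Prop
  | .ile e₁ e₂ => e₁.eval σ ≤ e₂.eval σ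
  | .rle e₁ e₂ => e₁.eval σ ≤ e₂.eval σ
  | .not b => ¬ b.Holds σ
  | .and b₁ b₂ => b₁.Holds σ ∧ b₂.Holds σ

/-- The number of steps needed to evaluate the test (both conjuncts are always evaluated). -/
def BExp.cost : BExp → ℕ
  | .ile e₁ e₂ => e₁.cost + e₂.cost + 1
  | .rle e₁ e₂ => e₁.cost + e₂.cost + 1
  | .not b => b.cost + 1
  | .and b₁ b₂ => b₁.cost + b₂.cost + 1

/-- Programs: assignments to registers, stores `a[p] := e` into arrays, composition,
conditionals and while loops. -/
inductive Cmd where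
  | nop
  | iset (x : ℕ) (e : IExp)
  | rset (x : ℕ) (e : RExp)
  | istore (a : ℕ) (p e : IExp)
  | rstore (a : ℕ) (p : IExp) (e : RExp)
  | seq (c₁ c₂ : Cmd)
  | cond (b : BExp) (c₁ c₂ : Cmd)
  | loop (b : BExp) (c : Cmd)

def State.iset (σ : State) (x v : ℕ) : State :=
  { σ with ivar := Function.update σ.ivar x v }

noncomputable def State.rset (σ : State) (x : ℕ) (v : ℝ) : State :=
  { σ with rvar := Function.update σ.rvar x v }

def State.istore (σ : State) (a p v : ℕ) : State :=
  { σ with iarr := Function.update σ.iarr a (Function.update (σ.iarr a) p v) }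

noncomputable def State.rstore (σ : State) (a p : ℕ) (v : ℝ) : State :=
  { σ with rarr := Function.update σ.rarr a (Function.update (σ.rarr a) p v) }

/-- `Exec c σ k τ`: the program `c`, started in the memory state `σ`, halts after exactly `k`
steps in the memory state `τ`. -/
inductive Exec : Cmd → State → ℕ → State → Prop where
  | nop (σ : State) : Exec .nop σ 1 σ
  | iset (σ : State) (x : ℕ) (e : IExp) :
      Exec (.iset x e) σ (e.cost + 1) (σ.iset x (e.eval σ))
  | rset (σ : State) (x : ℕ) (e : RExp) :
      Exec (.rset x e) σ (e.cost + 1) (σ.rset x (e.eval σ))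
  | istore (σ : State) (a : ℕ) (p e : IExp) :
      Exec (.istore a p e) σ (p.cost + e.cost + 1) (σ.istore a (p.eval σ) (e.eval σ))
  | rstore (σ : State) (a : ℕ) (p : IExp) (e : RExp) :
      Exec (.rstore a p e) σ (p.cost + e.cost + 1) (σ.rstore a (p.eval σ) (e.eval σ))
  | seq {σ ρ τ : State} {k l : ℕ} {c₁ c₂ : Cmd} (h₁ : Exec c₁ σ k ρ) (h₂ : Exec c₂ ρ l τ) :
      Exec (.seq c₁ c₂) σ (k + l + 1) τ
  | cond_true {σ τ : State} {k : ℕ} {b : BExp} {c₁ c₂ : Cmd} (hb : b.Holds σ)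
      (h : Exec c₁ σ k τ) : Exec (.cond b c₁ c₂) σ (b.cost + k + 1) τ
  | cond_false {σ τ : State} {k : ℕ} {b : BExp} {c₁ c₂ : Cmd} (hb : ¬ b.Holds σ)
      (h : Exec c₂ σ k τ) : Exec (.cond b c₁ c₂) σ (b.cost + k + 1) τ
  | loop_true {σ ρ τ : State} {k l : ℕ} {b : BExp} {c : Cmd} (hb : b.Holds σ)
      (h₁ : Exec c σ k ρ) (h₂ : Exec (.loop b c) ρ l τ) :
      Exec (.loop b c) σ (b.cost + k + l + 1) τ
  | loop_false {σ : State} {b : BExp} {c : Cmd} (hb : ¬ b.Holds σ) :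
      Exec (.loop b c) σ (b.cost + 1) σ

/-- The machine is deterministic: running time and final state are determined by the program and
the initial state. -/
theorem Exec.deterministic {c : Cmd} {σ τ τ' : State} {k k' : ℕ} (h : Exec c σ k τ)
    (h' : Exec c σ k' τ') : k = k' ∧ τ = τ' := by
  induction h generalizing k' τ' with
  | nop | iset | rset | istore | rstore => cases h'; exact ⟨rfl, rfl⟩
  | seq _ _ ih₁ ih₂ =>
    cases h' with
    | seq g₁ g₂ =>
      obtain ⟨rfl, rfl⟩ := ih₁ g₁
      obtain ⟨rfl, rfl⟩ := ih₂ g₂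
      exact ⟨rfl, rfl⟩
  | cond_true hb _ ih =>
    cases h' with
    | cond_true _ g => obtain ⟨rfl, rfl⟩ := ih g; exact ⟨rfl, rfl⟩
    | cond_false nb _ => exact absurd hb nb
  | cond_false hb _ ih =>
    cases h' with
    | cond_true nb _ => exact absurd nb hb
    | cond_false _ g => obtain ⟨rfl, rfl⟩ := ih g; exact ⟨rfl, rfl⟩
  | loop_true hb _ _ ih₁ ih₂ =>
    cases h' with
    | loop_true _ g₁ g₂ =>
      obtain ⟨rfl, rfl⟩ := ih₁ g₁
      obtain ⟨rfl, rfl⟩ := ih₂ g₂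
      exact ⟨rfl, rfl⟩
    | loop_false nb => exact absurd hb nb
  | loop_false hb =>
    cases h' with
    | loop_true nb _ _ => exact absurd nb hb
    | loop_false _ => exact ⟨rfl, rfl⟩

end RealRAM

/-- A set `M` of pairs is a generalized assignment between `A = Fin s` and `B = Fin t` with
demands `demA`, `demB` and capacities `capA`, `capB`: every object is matched to at least as many
objects of the other set as its demand and to at most as many as its capacity. -/
def IsGeneralizedAssignment {s t : ℕ} (demA capA : Fin s → ℕ) (demB capB : Fin t → ℕ)
    (M : Finset (Fin s × Fin t)) : Prop :=
  (∀ i, demA i ≤ (M.filter fun p => p.1 = i).card ∧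
    (M.filter fun p => p.1 = i).card ≤ capA i) ∧
  (∀ j, demB j ≤ (M.filter fun p => p.2 = j).card ∧
    (M.filter fun p => p.2 = j).card ≤ capB j)

/-- An instance of the limited-capacity assignment problem: the sizes of the two sets
`A = {a_1, …, a_s}` and `B = {b_1, …, b_t}`, the cost of every pair, and the capacities.
All demands are `1`. -/
structure LCAInstance where
  s : ℕ
  t : ℕ
  cost : Fin s → Fin t → ℝ
  capA : Fin s → ℕ
  capB : Fin t → ℕ

namespace LCAInstance

/-- The limited-capacity assignments: every object is matched to at least one object of the other
set, and to at most as many as its capacity allows. -/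
def IsAssignment (I : LCAInstance) (M : Finset (Fin I.s × Fin I.t)) : Prop :=
  IsGeneralizedAssignment (fun _ => 1) I.capA (fun _ => 1) I.capB M

/-- The cost of a set of pairs. -/
noncomputable def totalCost (I : LCAInstance) (M : Finset (Fin I.s × Fin I.t)) : ℝ :=
  ∑ p ∈ M, I.cost p.1 p.2

/-- `M` is a limited-capacity assignment of minimum cost. -/
def IsMinCostAssignment (I : LCAInstance) (M : Finset (Fin I.s × Fin I.t)) : Prop :=
  I.IsAssignment M ∧ ∀ M', I.IsAssignment M' → I.totalCost M ≤ I.totalCost M'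

/-- The memory state `σ` contains the instance as input: the sizes are in the natural registers
`0` and `1`, the capacities in the natural arrays `0` and `1`, and the cost matrix, row by row,
in the real array `0`.  The other memory cells may have any contents. -/
def IsInput (I : LCAInstance) (σ : RealRAM.State) : Prop :=
  σ.ivar 0 = I.s ∧ σ.ivar 1 = I.t ∧
  (∀ i : Fin I.s, σ.iarr 0 i = I.capA i) ∧
  (∀ j : Fin I.t, σ.iarr 1 j = I.capB j) ∧
  (∀ (i : Fin I.s) (j : Fin I.t), σ.rarr 0 (i * I.t + j) = I.cost i j)

/-- The set of pairs that the memory state `τ` contains as output: the natural array `2` holds,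
row by row, an `s × t` matrix in which the chosen pairs are marked by `1`. -/
def output (I : LCAInstance) (τ : RealRAM.State) : Finset (Fin I.s × Fin I.t) :=
  Finset.univ.filter fun p => τ.iarr 2 (p.1 * I.t + p.2) = 1

/-- Every instance can be stored in memory. -/
theorem exists_isInput (I : LCAInstance) : ∃ σ, I.IsInput σ := by
  refine ⟨⟨fun x => if x = 0 then I.s else I.t, fun _ => 0,
    fun a p => if a = 0 then (if h : p < I.s then I.capA ⟨p, h⟩ else 0)
      else (if h : p < I.t then I.capB ⟨p, h⟩ else 0),
    fun _ p => if h : p / I.t < I.s ∧ p % I.t < I.t then I.cost ⟨_, h.1⟩ ⟨_, h.2⟩ else 0⟩,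
    by simp, by simp, by simp, by simp, fun i j => ?_⟩
  have hd : ((i : ℕ) * I.t + j) / I.t = i := by
    rw [mul_comm, Nat.mul_add_div (by have := j.2; omega), Nat.div_eq_of_lt j.2, add_zero]
  have hm : ((i : ℕ) * I.t + j) % I.t = j := by
    rw [mul_comm, Nat.mul_add_mod, Nat.mod_eq_of_lt j.2]
  simp [hd, hm]

end LCAInstance

/-!
The program is a Hungarian method with shortest augmenting paths.

*Relaxation.*  A pair may be chosen several times, so that a solution is a multiset `x` of pairs
all of whose degrees lie between `1` and the capacity.  As the costs are nonnegative, replacing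
every positive multiplicity by `1` keeps a multiset feasible and does not raise its cost
(`Net.Feasible.truncate`, `Net.twiceCost_truncate`), so an optimal multiset yields an optimal
assignment.

*Optimality conditions.*  A potential `y` on the vertices with `y u + y v ≤ c u v`, with equality
on the chosen pairs, with `y v ≤ 0` where the degree is not `1`, and with `y v ≥ 0` where the degree
is below the capacity, proves by weak duality that no feasible multiset is cheaper than `x`
(`Net.Certified.optimal`).  These conditions do not ask for positive degrees, and hold for `x = 0`
and `y = 0`; the algorithm keeps them while it makes the degrees positive one by one.

*Augmentation.*  A vertex `r` of degree `0` is given degree `1` by growing an alternating tree from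
`r`.  In the tree, the potential increases on the side of `r` and decreases on the other side, up to
the first event: a vertex outside the tree is reached by a tight pair and joins the tree
(`Net.Search.insert`), or a tree vertex has potential `0` and may change its degree by one.  In the
latter case the tree path to `r` is flipped (`Net.Search.flip`, `Net.Flip.step`); the degrees of
the other vertices do not change, and no degree returns to `0`.  If no event is left, the other side
is saturated by fewer pairs than the side of `r` has vertices, and there is no solution
(`Net.Search.not_feasible`).

*Running time.*  Every step of the search takes linear time, and every step except the last one adds
a vertex to the tree.  So there are at most `n` augmentations of quadratic time.

Both sides are treated by the same code: the vertices are numbered consecutively, and since the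
machine cannot multiply, the pair of `a_i` and `b_j` is found at the sum `pos a_i + pos b_j` of two
precomputed numbers `i * t` and `j`, which is symmetric in the two vertices.
-/

open Finset

/-! ### Running time of programs -/

namespace RealRAM

/-- The program `c`, started in `σ`, halts after at most `K` steps in a state satisfying `Q`. -/
def Run (c : Cmd) (σ : State) (K : ℕ) (Q : State → Prop) : Prop :=
  ∃ (k : ℕ) (τ : State), Exec c σ k τ ∧ k ≤ K ∧ Q τ

theorem Run.mono {c : Cmd} {σ : State} {K K' : ℕ} {Q Q' : State → Prop} (h : Run c σ K Q)
    (hK : K ≤ K') (hQ : ∀ τ, Q τ → Q' τ) : Run c σ K' Q' := by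
  obtain ⟨k, τ, he, hk, hq⟩ := h
  exact ⟨k, τ, he, hk.trans hK, hQ _ hq⟩

theorem Run.seq {c₁ c₂ : Cmd} {σ : State} {K₁ K₂ : ℕ} {Q₁ Q : State → Prop}
    (h₁ : Run c₁ σ K₁ Q₁) (h₂ : ∀ ρ, Q₁ ρ → Run c₂ ρ K₂ Q) :
    Run (.seq c₁ c₂) σ (K₁ + K₂ + 1) Q := by
  obtain ⟨k, ρ, he, hk, hq⟩ := h₁
  obtain ⟨l, τ, he', hl, hq'⟩ := h₂ ρ hq
  exact ⟨_, τ, .seq he he', by omega, hq'⟩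

theorem Run.cond {b : BExp} {c₁ c₂ : Cmd} {σ : State} {K₁ K₂ : ℕ} {Q : State → Prop}
    (h₁ : b.Holds σ → Run c₁ σ K₁ Q) (h₂ : ¬ b.Holds σ → Run c₂ σ K₂ Q) :
    Run (.cond b c₁ c₂) σ (b.cost + (K₁ + K₂) + 1) Q := by
  by_cases hb : b.Holds σ
  · obtain ⟨k, τ, he, hk, hq⟩ := h₁ hb
    exact ⟨_, τ, .cond_true hb he, by omega, hq⟩
  · obtain ⟨k, τ, he, hk, hq⟩ := h₂ hb
    exact ⟨_, τ, .cond_false hb he, by omega, hq⟩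

/-- The rule for loops: `P m` is an invariant that allows at most `m` more iterations. -/
theorem Run.loop {b : BExp} {c : Cmd} {K : ℕ} {P : ℕ → State → Prop} {Q : State → Prop}
    (hbody : ∀ m σ, P m σ → b.Holds σ → ∃ m', m' < m ∧ Run c σ K (P m'))
    (hexit : ∀ m σ, P m σ → ¬ b.Holds σ → Q σ) :
    ∀ m σ, P m σ → Run (.loop b c) σ ((m + 1) * (b.cost + K + 1)) Q := by
  intro m
  induction m using Nat.strong_induction_on with
  | _ m ih =>
    intro σ hP
    by_cases hb : b.Holds σ
    · obtain ⟨m', hm, k, ρ, he, hk, hP'⟩ := hbody m σ hP hb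
      obtain ⟨l, τ, he', hl, hq⟩ := ih m' hm ρ hP'
      refine ⟨_, τ, .loop_true hb he he', ?_, hq⟩
      have h1 : (m' + 1) * (b.cost + K + 1) ≤ m * (b.cost + K + 1) := Nat.mul_le_mul_right _ hm
      have h2 : (m + 1) * (b.cost + K + 1) = m * (b.cost + K + 1) + (b.cost + K + 1) := by ring
      omega
    · exact ⟨_, σ, .loop_false hb, by nlinarith [Nat.zero_le (m * (b.cost + K + 1))],
        hexit m σ hP hb⟩

/-- Weakest precondition of a loop-free program; it is `False` for loops. -/
def Cmd.wp : Cmd → (State → Prop) → State → Prop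
  | .nop, Q, σ => Q σ
  | .iset x e, Q, σ => Q (σ.iset x (e.eval σ))
  | .rset x e, Q, σ => Q (σ.rset x (e.eval σ))
  | .istore a p e, Q, σ => Q (σ.istore a (p.eval σ) (e.eval σ))
  | .rstore a p e, Q, σ => Q (σ.rstore a (p.eval σ) (e.eval σ))
  | .seq c₁ c₂, Q, σ => c₁.wp (c₂.wp Q) σ
  | .cond b c₁ c₂, Q, σ => (b.Holds σ → c₁.wp Q σ) ∧ (¬ b.Holds σ → c₂.wp Q σ)
  | .loop _ _, _, _ => False

/-- An upper bound for the running time of a loop-free program, which counts both branches of a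
conditional. -/
def Cmd.time : Cmd → ℕ
  | .nop => 1
  | .iset _ e => e.cost + 1
  | .rset _ e => e.cost + 1
  | .istore _ p e => p.cost + e.cost + 1
  | .rstore _ p e => p.cost + e.cost + 1
  | .seq c₁ c₂ => c₁.time + c₂.time + 1
  | .cond b c₁ c₂ => b.cost + (c₁.time + c₂.time) + 1
  | .loop _ _ => 0

theorem Run.of_wp {c : Cmd} {σ : State} {Q : State → Prop} (h : c.wp Q σ) :
    Run c σ c.time Q := by
  induction c generalizing σ Q with
  | nop => exact ⟨_, _, .nop _, le_rfl, h⟩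
  | iset x e => exact ⟨_, _, .iset _ x e, le_rfl, h⟩
  | rset x e => exact ⟨_, _, .rset _ x e, le_rfl, h⟩
  | istore a p e => exact ⟨_, _, .istore _ a p e, le_rfl, h⟩
  | rstore a p e => exact ⟨_, _, .rstore _ a p e, le_rfl, h⟩
  | seq c₁ c₂ ih₁ ih₂ => exact Run.seq (ih₁ h) fun _ => ih₂
  | cond b c₁ c₂ ih₁ ih₂ => exact Run.cond (fun hb => ih₁ (h.1 hb)) fun hb => ih₂ (h.2 hb)
  | loop => exact h.elim

end RealRAM

/-! ### Multisets of pairs and optimality conditions -/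

/-- A bipartite network on the vertices `0, …, size - 1`.  Two vertices are joined if their sides
differ, and the pair `u, v` is stored, in every array indexed by pairs, at position
`pos u + pos v`. -/
structure Net where
  size : ℕ
  pos : ℕ → ℕ
  side : ℕ → ℕ
  cap : ℕ → ℕ
  cost : ℕ → ℝ

namespace Net

/-- There are two sides, and the position of a pair determines the pair. -/
structure Proper (N : Net) : Prop where
  side_le : ∀ v < N.size, N.side v ≤ 1
  pos_inj : ∀ u < N.size, ∀ v < N.size, ∀ u' < N.size, ∀ v' < N.size,
    N.side u ≠ N.side v → N.side u' ≠ N.side v' → N.pos u + N.pos v = N.pos u' + N.pos v' →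
    u = u' ∧ v = v' ∨ u = v' ∧ v = u'

/-- The degree of `v` in the multiset of pairs in which the pair at position `q` has
multiplicity `x q`. -/
def deg (N : Net) (x : ℕ → ℕ) (v : ℕ) : ℕ :=
  ∑ u ∈ range N.size, if N.side u ≠ N.side v then x (N.pos u + N.pos v) else 0

/-- All degrees of the multiset `x` of pairs are at least `1` and at most the capacity. -/
def Feasible (N : Net) (x : ℕ → ℕ) : Prop :=
  ∀ v < N.size, 1 ≤ N.deg x v ∧ N.deg x v ≤ N.cap v

/-- Twice the cost of the multiset `x` of pairs: every pair occurs in both orders. -/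
noncomputable def twiceCost (N : Net) (x : ℕ → ℕ) : ℝ :=
  ∑ u ∈ range N.size, ∑ v ∈ range N.size,
    if N.side u ≠ N.side v then (x (N.pos u + N.pos v) : ℝ) * N.cost (N.pos u + N.pos v) else 0

variable {N : Net} {x x₁ d par T : ℕ → ℕ} {y y' : ℕ → ℝ} {r : ℕ}

theorem Proper.side_eq (hN : N.Proper) {u v r : ℕ} (hu : u < N.size) (hv : v < N.size)
    (hr : r < N.size) (h₁ : N.side u ≠ N.side r) (h₂ : N.side v ≠ N.side r) :
    N.side u = N.side v := by
  have := hN.side_le u hu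
  have := hN.side_le v hv
  have := hN.side_le r hr
  omega

theorem one_le_deg {u v : ℕ} (hu : u < N.size) (hs : N.side u ≠ N.side v)
    (hx : 1 ≤ x (N.pos u + N.pos v)) : 1 ≤ N.deg x v :=
  hx.trans <| (if_pos hs).symm.le.trans <|
    single_le_sum (f := fun u => if N.side u ≠ N.side v then x (N.pos u + N.pos v) else 0)
      (fun _ _ => Nat.zero_le _) (mem_range.2 hu)

theorem deg_update (hN : N.Proper) {a b : ℕ} (ha : a < N.size) (hb : b < N.size)
    (hab : N.side a ≠ N.side b) (k : ℕ) {v : ℕ} (hv : v < N.size) :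
    N.deg (Function.update x (N.pos a + N.pos b) k) v +
        (if v = a ∨ v = b then x (N.pos a + N.pos b) else 0) =
      N.deg x v + (if v = a ∨ v = b then k else 0) := by
  have key : ∀ a < N.size, ∀ b < N.size, N.side a ≠ N.side b →
      N.deg (Function.update x (N.pos a + N.pos b) k) a + x (N.pos a + N.pos b) =
        N.deg x a + k := by
    intro a ha b hb hab
    unfold deg
    rw [← add_sum_erase _ _ (mem_range.2 hb), ← add_sum_erase _ _ (mem_range.2 hb)]
    have : ∑ u ∈ (range N.size).erase b, (if N.side u ≠ N.side a then
          Function.update x (N.pos a + N.pos b) k (N.pos u + N.pos a) else 0) =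
        ∑ u ∈ (range N.size).erase b, if N.side u ≠ N.side a then x (N.pos u + N.pos a) else 0 := by
      refine sum_congr rfl fun u hu => ?_
      rw [mem_erase, mem_range] at hu
      split_ifs with h
      · rw [Function.update_of_ne]
        intro he
        rcases hN.pos_inj u hu.2 a ha a ha b hb h hab he with h' | h'
        · exact hab (congrArg N.side h'.2)
        · exact hu.1 h'.1
      · rfl
    rw [this, if_pos hab.symm, if_pos hab.symm, add_comm (N.pos b), Function.update_self]
    omega
  by_cases h1 : v = a
  · subst h1; simpa using key v ha b hb hab
  by_cases h2 : v = b
  · subst h2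
    have := key v hb a ha hab.symm
    rw [add_comm (N.pos v)] at this
    simpa using this
  · simp only [h1, h2, or_self, if_false, add_zero]
    refine sum_congr rfl fun u hu => ?_
    split_ifs with h
    · rw [Function.update_of_ne]
      intro he
      rcases hN.pos_inj u (mem_range.1 hu) v hv a ha b hb h hab he with h' | h'
      · exact h2 h'.2
      · exact h1 h'.2
    · rfl

/-- Both sides have the same sum of degrees. -/
theorem sum_deg_eq (hN : N.Proper) (hr : r < N.size) (x : ℕ → ℕ) :
    ∑ v ∈ range N.size with N.side v = N.side r, N.deg x v =
      ∑ v ∈ range N.size with N.side v ≠ N.side r, N.deg x v := by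
  have h1 : ∑ v ∈ range N.size with N.side v = N.side r, N.deg x v =
      ∑ v ∈ range N.size with N.side v = N.side r,
        ∑ u ∈ range N.size with N.side u ≠ N.side r, x (N.pos u + N.pos v) := by
    refine sum_congr rfl fun v hv => ?_
    rw [mem_filter] at hv
    rw [deg, sum_filter, hv.2]
  have h2 : ∑ v ∈ range N.size with N.side v ≠ N.side r, N.deg x v =
      ∑ v ∈ range N.size with N.side v ≠ N.side r,
        ∑ u ∈ range N.size with N.side u = N.side r, x (N.pos u + N.pos v) := by
    refine sum_congr rfl fun v hv => ?_
    rw [mem_filter, mem_range] at hv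
    rw [deg, sum_filter]
    refine sum_congr rfl fun u hu => ?_
    rw [mem_range] at hu
    congr 1
    refine propext ⟨fun h => by_contra fun h' => h (hN.side_eq hu hv.1 hr h' hv.2), fun h => ?_⟩
    rw [h]; exact hv.2.symm
  rw [h1, h2, sum_comm]
  exact sum_congr rfl fun u _ => sum_congr rfl fun v _ => by rw [add_comm]

/-- The optimality conditions for the multiset `x` of pairs, the potential `y` and the target
degrees `d`: the potential is feasible, complementary slackness holds for the pairs in `x`, a
negative potential forces `d v` to be the capacity, and a positive one forces it to be `1`. -/
structure Certified (N : Net) (y : ℕ → ℝ) (x d : ℕ → ℕ) : Prop where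
  le_cost : ∀ u < N.size, ∀ v < N.size, N.side u ≠ N.side v →
    y u + y v ≤ N.cost (N.pos u + N.pos v)
  tight : ∀ u < N.size, ∀ v < N.size, N.side u ≠ N.side v → 1 ≤ x (N.pos u + N.pos v) →
    N.cost (N.pos u + N.pos v) ≤ y u + y v
  nonneg : ∀ v < N.size, d v < N.cap v → 0 ≤ y v
  nonpos : ∀ v < N.size, d v ≠ 1 → y v ≤ 0
  le_cap : ∀ v < N.size, d v ≤ N.cap v

/-- The potential bounds the cost from below, with equality on tight pairs. -/
theorem sum_potential (y : ℕ → ℝ) (x : ℕ → ℕ) :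
    ∑ u ∈ range N.size, ∑ v ∈ range N.size,
      (if N.side u ≠ N.side v then (x (N.pos u + N.pos v) : ℝ) * (y u + y v) else 0) =
    2 * ∑ v ∈ range N.size, y v * N.deg x v := by
  have h1 : ∑ u ∈ range N.size, ∑ v ∈ range N.size,
      (if N.side u ≠ N.side v then (x (N.pos u + N.pos v) : ℝ) * y v else 0) =
      ∑ v ∈ range N.size, y v * N.deg x v := by
    rw [sum_comm]
    refine sum_congr rfl fun v _ => ?_
    rw [deg, Nat.cast_sum, mul_sum]
    refine sum_congr rfl fun u _ => ?_
    rw [apply_ite Nat.cast, mul_ite, mul_comm (y v), Nat.cast_zero, mul_zero]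
  have h2 : ∑ u ∈ range N.size, ∑ v ∈ range N.size,
      (if N.side u ≠ N.side v then (x (N.pos u + N.pos v) : ℝ) * y u else 0) =
      ∑ v ∈ range N.size, y v * N.deg x v := by
    rw [← h1, sum_comm]
    refine sum_congr rfl fun v _ => sum_congr rfl fun u _ => ?_
    rw [add_comm (N.pos u)]
    exact if_congr ne_comm rfl rfl
  rw [two_mul]
  nth_rewrite 1 [← h2]
  rw [← h1, ← sum_add_distrib]
  refine sum_congr rfl fun v _ => ?_
  rw [← sum_add_distrib]
  refine sum_congr rfl fun u _ => ?_
  split_ifs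
  · ring
  · ring

/-- Weak duality: a certified multiset with the right degrees has minimum cost. -/
theorem Certified.optimal (h : N.Certified y x d) (hd : ∀ v < N.size, N.deg x v = d v)
    {x' : ℕ → ℕ} (hx' : N.Feasible x') : N.twiceCost x ≤ N.twiceCost x' := by
  have h1 : N.twiceCost x ≤ 2 * ∑ v ∈ range N.size, y v * N.deg x v := by
    rw [← sum_potential]
    refine sum_le_sum fun u hu => sum_le_sum fun v hv => ?_
    rw [mem_range] at hu hv
    split_ifs with hs
    · rcases Nat.eq_zero_or_pos (x (N.pos u + N.pos v)) with h0 | h0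
      · simp [h0]
      · exact mul_le_mul_of_nonneg_left (h.tight u hu v hv hs h0) (Nat.cast_nonneg _)
    · exact le_rfl
  have h2 : 2 * ∑ v ∈ range N.size, y v * N.deg x' v ≤ N.twiceCost x' := by
    rw [← sum_potential]
    refine sum_le_sum fun u hu => sum_le_sum fun v hv => ?_
    rw [mem_range] at hu hv
    split_ifs with hs
    · exact mul_le_mul_of_nonneg_left (h.le_cost u hu v hv hs) (Nat.cast_nonneg _)
    · exact le_rfl
  have h3 : ∑ v ∈ range N.size, y v * N.deg x v ≤ ∑ v ∈ range N.size, y v * N.deg x' v := by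
    refine sum_le_sum fun v hv => ?_
    rw [mem_range] at hv
    rw [hd v hv]
    obtain ⟨hl, hu⟩ := hx' v hv
    rcases lt_trichotomy (y v) 0 with hy | hy | hy
    · have : N.cap v ≤ d v := not_lt.1 fun hlt => absurd (h.nonneg v hv hlt) (not_le.2 hy)
      exact mul_le_mul_of_nonpos_left (by exact_mod_cast hu.trans this) hy.le
    · simp [hy]
    · have : d v = 1 := by_contra fun hne => absurd (h.nonpos v hv hne) (not_le.2 hy)
      exact mul_le_mul_of_nonneg_left (by rw [this]; exact_mod_cast hl) hy.le
  linarith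

/-- Replacing all positive multiplicities by `1` keeps the multiset feasible. -/
theorem Feasible.truncate (h : N.Feasible x)
    (hx₁ : ∀ u < N.size, ∀ v < N.size, N.side u ≠ N.side v →
      x₁ (N.pos u + N.pos v) = min 1 (x (N.pos u + N.pos v))) : N.Feasible x₁ := by
  intro v hv
  obtain ⟨h1, h2⟩ := h v hv
  constructor
  · obtain ⟨u, hu, hne⟩ := exists_ne_zero_of_sum_ne_zero (Nat.one_le_iff_ne_zero.1 h1)
    rw [mem_range] at hu
    split_ifs at hne with hs
    · exact one_le_deg hu hs (by rw [hx₁ u hu v hv hs]; omega)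
    · exact absurd rfl hne
  · refine le_trans (sum_le_sum fun u hu => ?_) h2
    rw [mem_range] at hu
    split_ifs with hs
    · rw [hx₁ u hu v hv hs]; exact min_le_right _ _
    · exact le_rfl

theorem twiceCost_truncate (hc : ∀ u < N.size, ∀ v < N.size, N.side u ≠ N.side v →
      0 ≤ N.cost (N.pos u + N.pos v))
    (hx₁ : ∀ u < N.size, ∀ v < N.size, N.side u ≠ N.side v →
      x₁ (N.pos u + N.pos v) = min 1 (x (N.pos u + N.pos v))) :
    N.twiceCost x₁ ≤ N.twiceCost x := by
  refine sum_le_sum fun u hu => sum_le_sum fun v hv => ?_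
  rw [mem_range] at hu hv
  split_ifs with hs
  · rw [hx₁ u hu v hv hs]
    exact mul_le_mul_of_nonneg_right (by exact_mod_cast min_le_right _ _) (hc u hu v hv hs)
  · exact le_rfl

/-! ### Growing the alternating tree -/

/-- The state of the search for an augmenting path from the root `r`.  A vertex `v` is in the
alternating tree if `1 ≤ T v`; a value `par v < N.size` is the parent of `v`, or the candidate
for it if `v` is outside the tree.  The target degree of `r` already counts the pair that the
augmentation will add.  Tree pairs are tight, and those that lead away from the root towards its
own side are in `x`.  Outside the tree, a vertex on the other side than the root has a candidate
with the smallest reduced cost, and a vertex on the side of the root has one exactly if a pair of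
`x` joins it to the tree. -/
structure Search (N : Net) (r : ℕ) (y : ℕ → ℝ) (x d par T : ℕ → ℕ) : Prop extends
    N.Certified y x d where
  root_lt : r < N.size
  root_deg : d r = 1
  root_mem : 1 ≤ T r
  deg_eq : ∀ v < N.size, N.deg x v + (if v = r then 1 else 0) = d v
  one_le : ∀ v ≤ r, 1 ≤ d v
  parent : ∃ rank : ℕ → ℕ, ∀ v < N.size, 1 ≤ T v →
    rank v < #{u ∈ range N.size | 1 ≤ T u} ∧ (v ≠ r → par v < N.size ∧ 1 ≤ T (par v) ∧
      rank (par v) < rank v ∧ N.side (par v) ≠ N.side v ∧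
      N.cost (N.pos (par v) + N.pos v) = y (par v) + y v ∧
      (N.side v = N.side r → 1 ≤ x (N.pos (par v) + N.pos v)))
  fringe_opp : ∀ v < N.size, ¬ 1 ≤ T v → N.side v ≠ N.side r →
    par v < N.size ∧ 1 ≤ T (par v) ∧ N.side (par v) = N.side r ∧
      ∀ u < N.size, 1 ≤ T u → N.side u = N.side r →
        N.cost (N.pos (par v) + N.pos v) - y (par v) ≤ N.cost (N.pos u + N.pos v) - y u
  fringe_same : ∀ v < N.size, ¬ 1 ≤ T v → N.side v = N.side r →
    (par v < N.size → 1 ≤ T (par v) ∧ N.side (par v) ≠ N.side r ∧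
      1 ≤ x (N.pos (par v) + N.pos v)) ∧
    ∀ u < N.size, 1 ≤ T u → N.side u ≠ N.side r → 1 ≤ x (N.pos u + N.pos v) → par v < N.size

/-- The vertex `v` limits the change of the potential: it can join the tree, or it is in the tree
and its degree may change by one in the direction in which the augmentation changes it. -/
def IsEvent (N : Net) (r : ℕ) (d par T : ℕ → ℕ) (v : ℕ) : Prop :=
  if 1 ≤ T v then (if N.side v = N.side r then 2 ≤ d v else d v < N.cap v) else par v < N.size

/-- The change of the potential at which the event of `v` takes place. -/
noncomputable def eventTime (N : Net) (r : ℕ) (y : ℕ → ℝ) (par T : ℕ → ℕ) (v : ℕ) : ℝ :=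
  if 1 ≤ T v then (if N.side v = N.side r then - y v else y v)
  else N.cost (N.pos (par v) + N.pos v) - y (par v) - y v

/-- The potential after the change by `δ` in the tree `T` with root `r`. -/
noncomputable def shift (N : Net) (r : ℕ) (T : ℕ → ℕ) (δ : ℝ) (y : ℕ → ℝ) (v : ℕ) : ℝ :=
  if 1 ≤ T v then (if N.side v = N.side r then y v + δ else y v - δ) else y v

theorem Search.eventTime_nonneg (h : N.Search r y x d par T) {v : ℕ} (hv : v < N.size)
    (he : N.IsEvent r d par T v) : 0 ≤ N.eventTime r y par T v := by
  unfold IsEvent at he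
  unfold eventTime
  split_ifs at he ⊢ with hT hs
  · have := h.nonpos v hv (by omega); linarith
  · exact h.nonneg v hv he
  · have hopp : N.side (par v) ≠ N.side v := by
      by_cases hs : N.side v = N.side r
      · rw [hs]; exact ((h.fringe_same v hv hT hs).1 he).2.1
      · rw [(h.fringe_opp v hv hT hs).2.2.1]; exact Ne.symm hs
    have := h.le_cost _ he v hv hopp
    linarith

/-- Changing the potential until the first event keeps the search state valid. -/
theorem Search.shift (hN : N.Proper) (h : N.Search r y x d par T) {δ : ℝ} (hδ : 0 ≤ δ)
    (hmin : ∀ v < N.size, N.IsEvent r d par T v → δ ≤ N.eventTime r y par T v) :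
    N.Search r (N.shift r T δ y) x d par T := by
  -- a pair of `x` that leaves the tree is an event at time `0`
  have hcross : ∀ u < N.size, ∀ v < N.size, N.side u ≠ N.side v → 1 ≤ T u → ¬ 1 ≤ T v →
      1 ≤ x (N.pos u + N.pos v) → δ = 0 := by
    intro u hu v hv hs hTu hTv hx
    refine le_antisymm ?_ hδ
    by_cases hvr : N.side v = N.side r
    · obtain ⟨h1, h2⟩ := h.fringe_same v hv hTv hvr
      have hp := h2 u hu hTu (hvr ▸ hs) hx
      have := hmin v hv (by simpa [IsEvent, hTv] using hp)
      rw [eventTime, if_neg hTv] at this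
      have := h.tight _ hp v hv (hvr ▸ (h1 hp).2.1) (h1 hp).2.2
      linarith
    · obtain ⟨hp, -, -, hm⟩ := h.fringe_opp v hv hTv hvr
      have hur : N.side u = N.side r := by
        by_contra hur
        exact hs (hN.side_eq hu hv h.root_lt hur hvr)
      have := hmin v hv (by simpa [IsEvent, hTv] using hp)
      rw [eventTime, if_neg hTv] at this
      have := hm u hu hTu hur
      have := h.tight u hu v hv hs hx
      linarith
  have hle : ∀ u < N.size, ∀ v < N.size, N.side u ≠ N.side v → 1 ≤ T u → ¬ 1 ≤ T v →
      N.shift r T δ y u + N.shift r T δ y v ≤ N.cost (N.pos u + N.pos v) := by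
    intro u hu v hv hs hTu hTv
    simp only [Net.shift, if_pos hTu, if_neg hTv]
    have h0 := h.le_cost u hu v hv hs
    split_ifs with hur
    · obtain ⟨hp, -, -, hm⟩ := h.fringe_opp v hv hTv (hur ▸ hs.symm)
      have := hmin v hv (by simpa [IsEvent, hTv] using hp)
      rw [eventTime, if_neg hTv] at this
      have := hm u hu hTu hur
      linarith
    · linarith
  have hsum : ∀ u < N.size, ∀ v < N.size, N.side u ≠ N.side v → 1 ≤ T u → 1 ≤ T v →
      N.shift r T δ y u + N.shift r T δ y v = y u + y v := by
    intro u hu v hv hs hTu hTv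
    simp only [Net.shift, if_pos hTu, if_pos hTv]
    split_ifs with h1 h2 h2
    · exact absurd (h1.trans h2.symm) hs
    · ring
    · ring
    · exact absurd (hN.side_eq hu hv h.root_lt h1 h2) hs
  have hzero : δ = 0 → N.shift r T δ y = y := by
    intro h0; ext v; simp [Net.shift, h0]
  refine { h with
    le_cost := ?_, tight := ?_, nonneg := ?_, nonpos := ?_, parent := ?_, fringe_opp := ?_ }
  · intro u hu v hv hs
    by_cases hTu : 1 ≤ T u <;> by_cases hTv : 1 ≤ T v
    · rw [hsum u hu v hv hs hTu hTv]; exact h.le_cost u hu v hv hs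
    · exact hle u hu v hv hs hTu hTv
    · rw [add_comm, add_comm (N.pos u)]; exact hle v hv u hu hs.symm hTv hTu
    · simp only [Net.shift, if_neg hTu, if_neg hTv]; exact h.le_cost u hu v hv hs
  · intro u hu v hv hs hx
    by_cases hTu : 1 ≤ T u <;> by_cases hTv : 1 ≤ T v
    · rw [hsum u hu v hv hs hTu hTv]; exact h.tight u hu v hv hs hx
    · rw [hzero (hcross u hu v hv hs hTu hTv hx)]; exact h.tight u hu v hv hs hx
    · rw [hzero (hcross v hv u hu hs.symm hTv hTu (by rwa [add_comm]))]
      exact h.tight u hu v hv hs hx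
    · simp only [Net.shift, if_neg hTu, if_neg hTv]; exact h.tight u hu v hv hs hx
  · intro v hv hc
    have h0 := h.nonneg v hv hc
    unfold Net.shift
    split_ifs with hT hs
    · linarith
    · have := hmin v hv (by simpa [IsEvent, hT, hs] using hc)
      simp only [eventTime, if_pos hT, if_neg hs] at this
      linarith
    · exact h0
  · intro v hv hc
    have h0 := h.nonpos v hv hc
    unfold Net.shift
    split_ifs with hT hs
    · have hvr : v ≠ r := fun hvr => hc (hvr ▸ h.root_deg)
      -- the pair of `v` and its parent is in `x`, so `d v` is positive and `v` is an event
      have h2 : 2 ≤ d v := by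
        obtain ⟨rank, hrank⟩ := h.parent
        obtain ⟨hp, -, -, hps, -, hx⟩ := (hrank v hv hT).2 hvr
        have h1 := h.deg_eq v hv
        rw [if_neg hvr, add_zero] at h1
        have := one_le_deg hp hps (hx hs)
        omega
      have := hmin v hv (by simpa [IsEvent, hT, hs] using h2)
      simp only [eventTime, if_pos hT, if_pos hs] at this
      linarith
    · linarith
    · exact h0
  · obtain ⟨rank, hrank⟩ := h.parent
    refine ⟨rank, fun v hv hT => ⟨(hrank v hv hT).1, fun hvr => ?_⟩⟩
    obtain ⟨h1, h2, h3, h4, h5, h6⟩ := (hrank v hv hT).2 hvr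
    exact ⟨h1, h2, h3, h4, by rw [hsum _ h1 v hv h4 h2 hT, h5], h6⟩
  · intro v hv hT hs
    obtain ⟨h1, h2, h3, h4⟩ := h.fringe_opp v hv hT hs
    refine ⟨h1, h2, h3, fun u hu hTu hur => ?_⟩
    have := h4 u hu hTu hur
    simp only [Net.shift, if_pos h2, if_pos h3, if_pos hTu, if_pos hur]
    linarith

theorem Search.congr (h : N.Search r y x d par T) (hy : ∀ v < N.size, y' v = y v) :
    N.Search r y' x d par T := by
  refine { h with
    le_cost := ?_, tight := ?_, nonneg := ?_, nonpos := ?_, parent := ?_, fringe_opp := ?_ }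
  · intro u hu v hv
    rw [hy u hu, hy v hv]
    exact h.le_cost u hu v hv
  · intro u hu v hv
    rw [hy u hu, hy v hv]
    exact h.tight u hu v hv
  · intro v hv
    rw [hy v hv]
    exact h.nonneg v hv
  · intro v hv
    rw [hy v hv]
    exact h.nonpos v hv
  · obtain ⟨rank, hrank⟩ := h.parent
    refine ⟨rank, fun v hv hT => ⟨(hrank v hv hT).1, fun hvr => ?_⟩⟩
    obtain ⟨h1, h2⟩ := (hrank v hv hT).2 hvr
    rw [hy _ h1, hy v hv]
    exact ⟨h1, h2⟩
  · intro v hv hT hs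
    obtain ⟨h1, h2, h3, h4⟩ := h.fringe_opp v hv hT hs
    refine ⟨h1, h2, h3, fun u hu hTu hur => ?_⟩
    rw [hy _ h1, hy u hu]
    exact h4 u hu hTu hur

/-- The event that limits the change of the potential takes place after the change. -/
theorem Search.eventTime_shift (h : N.Search r y' x d par T) {v : ℕ} (hv : v < N.size)
    (he : N.IsEvent r d par T v)
    (hy : ∀ u < N.size, y' u = N.shift r T (N.eventTime r y par T v) y u) :
    N.eventTime r y' par T v = 0 := by
  unfold IsEvent at he
  by_cases hT : 1 ≤ T v
  · have := hy v hv
    by_cases hs : N.side v = N.side r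
    · simp only [eventTime, Net.shift, if_pos hT, if_pos hs] at this ⊢
      linarith
    · simp only [eventTime, Net.shift, if_pos hT, if_neg hs] at this ⊢
      linarith
  · rw [if_neg hT] at he
    by_cases hs : N.side v = N.side r
    · -- the vertex and its parent are joined by a pair of `x`, which is always tight
      obtain ⟨-, h2, h3⟩ := (h.fringe_same v hv hT hs).1 he
      have hopp : N.side (par v) ≠ N.side v := hs ▸ h2
      have := h.tight _ he v hv hopp h3
      have := h.le_cost _ he v hv hopp
      rw [eventTime, if_neg hT]
      linarith
    · obtain ⟨-, h2, h3, -⟩ := h.fringe_opp v hv hT hs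
      have e1 := hy v hv
      have e2 := hy _ he
      simp only [eventTime, Net.shift, if_neg hT, if_pos h2, if_pos h3] at e1 e2 ⊢
      linarith

open Classical in
/-- The parents after the vertex `b` has joined the tree: every vertex outside the tree for which
`b` is a better parent, or a parent at all, switches to `b`. -/
noncomputable def scan (N : Net) (r : ℕ) (y : ℕ → ℝ) (x par T : ℕ → ℕ) (b v : ℕ) : ℕ :=
  if ¬ 1 ≤ T v ∧ N.side v ≠ N.side b then
    if N.side b = N.side r then
      if N.cost (N.pos b + N.pos v) - y b ≤ N.cost (N.pos (par v) + N.pos v) - y (par v) then b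
      else par v
    else if 1 ≤ x (N.pos b + N.pos v) then b else par v
  else par v

/-- A vertex whose event takes place now joins the tree. -/
theorem Search.insert (hN : N.Proper) (h : N.Search r y x d par T) {b : ℕ} (hb : b < N.size)
    (hTb : ¬ 1 ≤ T b) (hpb : par b < N.size) (h0 : N.eventTime r y par T b = 0)
    {par' T' : ℕ → ℕ} (hT' : T' = Function.update T b 1)
    (hpar : ∀ v < N.size, par' v = N.scan r y x par T' b v) :
    N.Search r y x d par' T' ∧
      #{u ∈ range N.size | 1 ≤ T' u} = #{u ∈ range N.size | 1 ≤ T u} + 1 := by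
  have hTv : ∀ v, 1 ≤ T' v ↔ v = b ∨ 1 ≤ T v := by
    intro v
    rw [hT', Function.update_apply]
    split_ifs with hv <;> simp [hv]
  have hcard : #{u ∈ range N.size | 1 ≤ T' u} = #{u ∈ range N.size | 1 ≤ T u} + 1 := by
    rw [← card_insert_of_notMem (a := b) (s := {u ∈ range N.size | 1 ≤ T u}) (by simp; omega)]
    congr 1
    ext u
    simp only [mem_filter, mem_insert, hTv, mem_range]
    constructor
    · rintro ⟨h1, h2 | h2⟩
      · exact .inl h2
      · exact .inr ⟨h1, h2⟩
    · rintro (h1 | ⟨h1, h2⟩)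
      · exact ⟨h1 ▸ hb, .inl h1⟩
      · exact ⟨h1, .inr h2⟩
  have hold : ∀ v < N.size, 1 ≤ T' v → par' v = par v := by
    intro v hv hT
    rw [hpar v hv, scan, if_neg (fun hh => hh.1 hT)]
  rw [eventTime, if_neg hTb] at h0
  refine ⟨{ h with root_mem := ?_, parent := ?_, fringe_opp := ?_, fringe_same := ?_ }, hcard⟩
  · exact (hTv r).2 (.inr h.root_mem)
  · obtain ⟨rank, hrank⟩ := h.parent
    -- the rank of a vertex is the number of vertices that joined the tree before it
    refine ⟨Function.update rank b (#{u ∈ range N.size | 1 ≤ T u}), fun v hv hT => ?_⟩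
    rw [hcard, hold v hv hT]
    by_cases hvb : v = b
    · subst hvb
      simp only [Function.update_self]
      refine ⟨Nat.lt_succ_self _, fun hvr => ?_⟩
      have hpv : 1 ≤ T (par v) ∧ N.side (par v) ≠ N.side v ∧
          (N.side v = N.side r → 1 ≤ x (N.pos (par v) + N.pos v)) := by
        by_cases hs : N.side v = N.side r
        · have := (h.fringe_same v hv hTb hs).1 hpb
          exact ⟨this.1, hs ▸ this.2.1, fun _ => this.2.2⟩
        · have := h.fringe_opp v hv hTb hs
          exact ⟨this.2.1, this.2.2.1 ▸ Ne.symm hs, fun h' => absurd h' hs⟩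
      have hne : par v ≠ v := fun he => hTb (he ▸ hpv.1)
      rw [Function.update_of_ne hne]
      exact ⟨hpb, (hTv _).2 (.inr hpv.1), (hrank _ hpb hpv.1).1, hpv.2.1, by linarith, hpv.2.2⟩
    · have hTv' : 1 ≤ T v := ((hTv v).1 hT).resolve_left hvb
      rw [Function.update_of_ne hvb]
      refine ⟨(hrank v hv hTv').1.trans (Nat.lt_succ_self _), fun hvr => ?_⟩
      obtain ⟨h1, h2, h3, h4⟩ := (hrank v hv hTv').2 hvr
      have hne : par v ≠ b := fun he => hTb (he ▸ h2)
      rw [Function.update_of_ne hne]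
      exact ⟨h1, (hTv _).2 (.inr h2), h3, h4⟩
  · intro v hv hT hs
    have hT0 : ¬ 1 ≤ T v := fun hh => hT ((hTv v).2 (.inr hh))
    obtain ⟨h1, h2, h3, h4⟩ := h.fringe_opp v hv hT0 hs
    rw [hpar v hv, scan]
    by_cases hbr : N.side b = N.side r
    · rw [if_pos ⟨hT, hbr ▸ hs⟩, if_pos hbr]
      split_ifs with hlt
      · refine ⟨hb, (hTv b).2 (.inl rfl), hbr, fun u hu hTu hur => ?_⟩
        rcases (hTv u).1 hTu with rfl | hTu
        · exact le_rfl
        · exact hlt.trans (h4 u hu hTu hur)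
      · refine ⟨h1, (hTv _).2 (.inr h2), h3, fun u hu hTu hur => ?_⟩
        rcases (hTv u).1 hTu with rfl | hTu
        · exact (not_le.1 hlt).le
        · exact h4 u hu hTu hur
    · rw [if_neg (fun hh => hh.2 (hN.side_eq hv hb h.root_lt hs hbr))]
      refine ⟨h1, (hTv _).2 (.inr h2), h3, fun u hu hTu hur => ?_⟩
      rcases (hTv u).1 hTu with rfl | hTu
      · exact absurd hur hbr
      · exact h4 u hu hTu hur
  · intro v hv hT hs
    have hT0 : ¬ 1 ≤ T v := fun hh => hT ((hTv v).2 (.inr hh))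
    obtain ⟨h1, h2⟩ := h.fringe_same v hv hT0 hs
    rw [hpar v hv, scan]
    by_cases hbr : N.side b = N.side r
    · rw [if_neg (fun hh => hh.2 (hs.trans hbr.symm))]
      refine ⟨fun hp => ⟨(hTv _).2 (.inr (h1 hp).1), (h1 hp).2⟩, fun u hu hTu hur hx => ?_⟩
      rcases (hTv u).1 hTu with rfl | hTu
      · exact absurd hbr hur
      · exact h2 u hu hTu hur hx
    · rw [if_pos ⟨hT, hs ▸ Ne.symm hbr⟩, if_neg hbr]
      split_ifs with hx
      · exact ⟨fun _ => ⟨(hTv b).2 (.inl rfl), hbr, hx⟩, fun _ _ _ _ _ => hb⟩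
      · refine ⟨fun hp => ⟨(hTv _).2 (.inr (h1 hp).1), (h1 hp).2⟩, fun u hu hTu hur hx' => ?_⟩
        rcases (hTv u).1 hTu with rfl | hTu
        · exact absurd hx' hx
        · exact h2 u hu hTu hur hx'

/-- If no event is left, the vertices on the side of the root outnumber the total capacity of the
other side. -/
theorem Search.not_feasible (hN : N.Proper) (h : N.Search r y x d par T)
    (hno : ∀ v < N.size, ¬ N.IsEvent r d par T v) (x' : ℕ → ℕ) : ¬ N.Feasible x' := by
  intro hx'
  have hopp : ∀ v < N.size, N.side v ≠ N.side r → 1 ≤ T v ∧ N.cap v = d v := by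
    intro v hv hs
    have hT : 1 ≤ T v := by
      by_contra hT
      exact hno v hv (by simpa [IsEvent, hT] using (h.fringe_opp v hv hT hs).1)
    have := hno v hv
    simp only [IsEvent, if_pos hT, if_neg hs] at this
    exact ⟨hT, le_antisymm (not_lt.1 this) (h.le_cap v hv)⟩
  have hsame : ∀ v < N.size, N.side v = N.side r → N.deg x v + (if v = r then 1 else 0) ≤ 1 := by
    intro v hv hs
    by_cases hT : 1 ≤ T v
    · have := hno v hv
      simp only [IsEvent, if_pos hT, if_pos hs] at this
      rw [h.deg_eq v hv]; omega
    · have hvr : v ≠ r := fun he => hT (he ▸ h.root_mem)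
      have hp : ¬ par v < N.size := by
        have := hno v hv
        simpa [IsEvent, hT] using this
      have : N.deg x v = 0 := by
        refine sum_eq_zero fun u hu => ?_
        rw [mem_range] at hu
        split_ifs with hus
        · by_contra hx0
          exact hp ((h.fringe_same v hv hT hs).2 u hu (hopp u hu (hs ▸ hus)).1 (hs ▸ hus)
            (Nat.one_le_iff_ne_zero.2 hx0))
        · rfl
      simp [this, hvr]
  -- `x` has fewer pairs than the side of `r` has vertices, and saturates the other side
  have e1 := sum_deg_eq hN h.root_lt x
  have e2 := sum_deg_eq hN h.root_lt x'
  have l1 : ∑ v ∈ range N.size with N.side v = N.side r, (N.deg x v + if v = r then 1 else 0) ≤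
      ∑ v ∈ range N.size with N.side v = N.side r, 1 :=
    sum_le_sum fun v hv => hsame v (mem_range.1 (mem_filter.1 hv).1) (mem_filter.1 hv).2
  rw [sum_add_distrib, sum_ite_eq' _ r, if_pos (by simp [h.root_lt])] at l1
  have l2 : ∑ v ∈ range N.size with N.side v = N.side r, 1 ≤
      ∑ v ∈ range N.size with N.side v = N.side r, N.deg x' v :=
    sum_le_sum fun v hv => (hx' v (mem_range.1 (mem_filter.1 hv).1)).1
  have l3 : ∑ v ∈ range N.size with N.side v ≠ N.side r, N.deg x' v ≤
      ∑ v ∈ range N.size with N.side v ≠ N.side r, N.deg x v := by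
    refine sum_le_sum fun v hv => ?_
    obtain ⟨hv, hs⟩ := mem_filter.1 hv
    rw [mem_range] at hv
    have hvr : v ≠ r := fun he => hs (he ▸ rfl)
    have := h.deg_eq v hv
    rw [if_neg hvr, add_zero] at this
    rw [this, ← (hopp v hv hs).2]
    exact (hx' v hv).2
  omega

/-! ### Flipping the augmenting path -/

/-- The state while the tree path from `p` to the root is being flipped: the pairs behind `p` have
been changed, so the degree of `p` is off by one, and that of the root still lacks its new pair; the
two defects cancel when `p` arrives at the root.  The tree is given by `mem`, and only its pairs
in front of `p`, measured by `rank`, still have to be intact. -/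
structure Flip (N : Net) (r : ℕ) (y : ℕ → ℝ) (x d par : ℕ → ℕ) (rank : ℕ → ℕ) (mem : ℕ → Prop)
    (p : ℕ) : Prop extends N.Certified y x d where
  root_lt : r < N.size
  lt : p < N.size
  mem_cur : mem p
  deg_eq : ∀ v < N.size, (N.deg x v : ℤ) + (if v = r then 1 else 0) +
    (if v = p then (if N.side v = N.side r then -1 else 1) else 0) = d v
  parent : ∀ v < N.size, mem v → rank v ≤ rank p → v ≠ r → par v < N.size ∧ mem (par v) ∧
      rank (par v) < rank v ∧ N.side (par v) ≠ N.side v ∧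
      N.cost (N.pos (par v) + N.pos v) = y (par v) + y v ∧
      (N.side v = N.side r → 1 ≤ x (N.pos (par v) + N.pos v))

/-- The search can start at a vertex of degree `0` and positive capacity. -/
theorem Certified.search (h : N.Certified y x d) (hdeg : ∀ v < N.size, N.deg x v = d v)
    (hr : r < N.size) (hd : d r = 0) (hc : 1 ≤ N.cap r) (hpos : ∀ v < r, 1 ≤ d v) {d' : ℕ → ℕ}
    (hd' : d' = Function.update d r 1) (hT : ∀ v < N.size, T v = if v = r then 1 else 0)
    (hpar : ∀ v < N.size, par v = if N.side v = N.side r then N.size else r) :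
    N.Search r y x d' par T := by
  subst hd'
  have hTv : ∀ v < N.size, 1 ≤ T v → v = r := by
    intro v hv hTv
    rw [hT v hv] at hTv
    by_contra hne
    simp [hne] at hTv
  have hTr : 1 ≤ T r := by simp [hT r hr]
  refine { h with
    root_lt := hr, root_deg := by simp, root_mem := hTr, nonneg := ?_, nonpos := ?_,
    le_cap := ?_, deg_eq := ?_, one_le := ?_, parent := ?_, fringe_opp := ?_, fringe_same := ?_ }
  · intro v hv hlt
    by_cases hvr : v = r
    · exact h.nonneg v hv (by subst hvr; omega)
    · rw [Function.update_of_ne hvr] at hlt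
      exact h.nonneg v hv hlt
  · intro v hv hne
    by_cases hvr : v = r
    · exact h.nonpos v hv (by subst hvr; omega)
    · rw [Function.update_of_ne hvr] at hne
      exact h.nonpos v hv hne
  · intro v hv
    by_cases hvr : v = r
    · subst hvr; simpa using hc
    · rw [Function.update_of_ne hvr]; exact h.le_cap v hv
  · intro v hv
    rw [hdeg v hv]
    by_cases hvr : v = r
    · subst hvr; simp [hd]
    · simp [hvr]
  · intro v hv
    by_cases hvr : v = r
    · simp [hvr]
    · rw [Function.update_of_ne hvr]; exact hpos v (by omega)
  · refine ⟨fun _ => 0, fun v hv hTv' => ⟨card_pos.2 ⟨v, by simp [hv, hTv']⟩, fun hvr => ?_⟩⟩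
    exact absurd (hTv v hv hTv') hvr
  · intro v hv _ hs
    rw [hpar v hv, if_neg hs]
    exact ⟨hr, hTr, rfl, fun u hu hTu _ => by rw [hTv u hu hTu]⟩
  · intro v hv _ hs
    rw [hpar v hv, if_pos hs]
    exact ⟨fun hlt => absurd hlt (lt_irrefl _), fun u hu hTu hur => absurd (hTv u hu hTu ▸ rfl) hur⟩

/-- An event at time `0` in the tree ends the search: the degree of its vertex changes, and the
path to the root can be flipped. -/
theorem Search.flip (h : N.Search r y x d par T) {t : ℕ} (ht : t < N.size) (hTt : 1 ≤ T t)
    (he : N.IsEvent r d par T t) (h0 : N.eventTime r y par T t = 0) {d' : ℕ → ℕ}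
    (hd' : d' = Function.update d t (if N.side t = N.side r then d t - 1 else d t + 1)) :
    (∃ rank mem, N.Flip r y x d' par rank mem t ∧ rank t < N.size) ∧ ∀ v ≤ r, 1 ≤ d' v := by
  rw [IsEvent, if_pos hTt] at he
  have hy : y t = 0 := by
    rw [eventTime, if_pos hTt] at h0
    split_ifs at h0 <;> linarith
  subst hd'
  constructor
  · obtain ⟨rank, hrank⟩ := h.parent
    have hlt : rank t < N.size := by
      refine (hrank t ht hTt).1.trans_le ((card_filter_le _ _).trans ?_)
      simp
    refine ⟨rank, fun v => 1 ≤ T v, { h with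
      lt := ht, mem_cur := hTt, nonneg := ?_, nonpos := ?_, le_cap := ?_, deg_eq := ?_,
      parent := fun v hv hm _ hvr => (hrank v hv hm).2 hvr }, hlt⟩
    · intro v hv hc
      by_cases hvt : v = t
      · rw [hvt, hy]
      · rw [Function.update_of_ne hvt] at hc
        exact h.nonneg v hv hc
    · intro v hv hc
      by_cases hvt : v = t
      · rw [hvt, hy]
      · rw [Function.update_of_ne hvt] at hc
        exact h.nonpos v hv hc
    · intro v hv
      have := h.le_cap v hv
      by_cases hvt : v = t
      · subst hvt
        rw [Function.update_self]
        split_ifs at he ⊢ <;> omega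
      · rwa [Function.update_of_ne hvt]
    · intro v hv
      have := h.deg_eq v hv
      by_cases hvt : v = t
      · subst hvt
        rw [Function.update_self, if_pos rfl]
        split_ifs at he this ⊢ <;> push_cast <;> omega
      · rw [Function.update_of_ne hvt, if_neg hvt, ← this]
        push_cast
        ring
  · intro v hv
    have := h.one_le v hv
    by_cases hvt : v = t
    · subst hvt
      rw [Function.update_self]
      split_ifs at he ⊢ <;> omega
    · rwa [Function.update_of_ne hvt]

theorem Flip.deg_root {rank : ℕ → ℕ} {mem : ℕ → Prop} (h : N.Flip r y x d par rank mem r) :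
    ∀ v < N.size, N.deg x v = d v := by
  intro v hv
  have := h.deg_eq v hv
  by_cases hvr : v = r
  · simp only [hvr, if_true] at this ⊢; omega
  · simp only [hvr, if_false] at this; omega

theorem Flip.step (hN : N.Proper) {rank : ℕ → ℕ} {mem : ℕ → Prop} {p : ℕ}
    (h : N.Flip r y x d par rank mem p) (hp : p ≠ r) :
    N.Flip r y (Function.update x (N.pos (par p) + N.pos p)
      (if N.side p = N.side r then x (N.pos (par p) + N.pos p) - 1
        else x (N.pos (par p) + N.pos p) + 1)) d par rank mem (par p) ∧ rank (par p) < rank p := by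
  obtain ⟨h1, h2, h3, h4, h5, h6⟩ := h.parent p h.lt h.mem_cur le_rfl hp
  have hne : par p ≠ p := fun he => h4 (congrArg N.side he)
  refine ⟨{ h with tight := ?_, lt := h1, mem_cur := h2, deg_eq := ?_, parent := ?_ }, h3⟩
  · intro u hu v hv hs hx
    rw [Function.update_apply] at hx
    split_ifs at hx with he
    · rcases hN.pos_inj u hu v hv _ h1 p h.lt hs h4 he with ⟨rfl, rfl⟩ | ⟨rfl, rfl⟩
      · exact h5.le
      · rw [add_comm, add_comm (y _)]; exact h5.le
    · rcases hN.pos_inj u hu v hv _ h1 p h.lt hs h4 he with ⟨rfl, rfl⟩ | ⟨rfl, rfl⟩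
      · exact h5.le
      · rw [add_comm, add_comm (y _)]; exact h5.le
    · exact h.tight u hu v hv hs hx
  · intro v hv
    have hd := h.deg_eq v hv
    have hu := deg_update (x := x) hN h1 h.lt h4 (if N.side p = N.side r then
      x (N.pos (par p) + N.pos p) - 1 else x (N.pos (par p) + N.pos p) + 1) hv
    generalize N.deg (Function.update x _ _) v = D at hu ⊢
    have hside : N.side p = N.side r ∧ N.side (par p) ≠ N.side r ∧
        1 ≤ x (N.pos (par p) + N.pos p) ∨ N.side p ≠ N.side r ∧ N.side (par p) = N.side r := by
      by_cases hs : N.side p = N.side r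
      · exact .inl ⟨hs, hs ▸ h4, h6 hs⟩
      · exact .inr ⟨hs, by_contra fun hs' => h4 (hN.side_eq h1 h.lt h.root_lt hs' hs)⟩
    by_cases hv1 : v = p
    · subst hv1
      rcases hside with ⟨ha, hb, hc⟩ | ⟨ha, hb⟩
      · simp only [ha, hne.symm, or_true, if_true, if_false] at hd hu ⊢
        omega
      · simp only [ha, hne.symm, or_true, if_true, if_false] at hd hu ⊢
        omega
    by_cases hv2 : v = par p
    · subst hv2
      rcases hside with ⟨ha, hb, hc⟩ | ⟨ha, hb⟩
      · simp only [ha, hb, hv1, true_or, if_true, if_false] at hd hu ⊢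
        omega
      · simp only [ha, hb, hv1, true_or, if_true, if_false] at hd hu ⊢
        omega
    · simp only [hv1, hv2, or_self, if_false] at hd hu ⊢
      omega
  · intro v hv hm hr hvr
    obtain ⟨g1, g2, g3, g4, g5, g6⟩ := h.parent v hv hm (hr.trans h3.le) hvr
    refine ⟨g1, g2, g3, g4, g5, fun hs => ?_⟩
    rw [Function.update_of_ne]
    · exact g6 hs
    -- a pair in front of `par p` is not the pair that has just been changed
    intro he
    rcases hN.pos_inj _ g1 v hv _ h1 p h.lt g4 h4 he with ⟨-, rfl⟩ | ⟨h', rfl⟩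
    · omega
    · rw [h'] at g3; omega

end Net

/-! ### The search program -/

namespace RealRAM

/-! Names of the registers and arrays.  The registers `regS`, `regT`, `regFlag` and the arrays
`arrCapA`, `arrCapB`, `arrX`, `arrCost` are those fixed by the input and output format. -/

@[simp] abbrev regS : ℕ := 0
@[simp] abbrev regT : ℕ := 1
@[simp] abbrev regFlag : ℕ := 2
/-- The number of vertices. -/
@[simp] abbrev regSize : ℕ := 3
/-- The number of pairs of vertices on different sides. -/
@[simp] abbrev regPairs : ℕ := 4
/-- The counter of all `forTo` loops. -/
@[simp] abbrev regI : ℕ := 5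
@[simp] abbrev regRoot : ℕ := 6
/-- The vertex of the first event. -/
@[simp] abbrev regBest : ℕ := 7
/-- `1` as soon as the search has ended. -/
@[simp] abbrev regDone : ℕ := 8
/-- `1` if the vertex `regI` has an event. -/
@[simp] abbrev regEvent : ℕ := 9
/-- The current vertex on the path that is being flipped. -/
@[simp] abbrev regP : ℕ := 10
/-- The position of the pair of `regP` and its parent. -/
@[simp] abbrev regQ : ℕ := 11
/-- The real register with the time of the event of `regBest`. -/
@[simp] abbrev regDelta : ℕ := 0
/-- The real register with the time of the event of `regI`. -/
@[simp] abbrev regVal : ℕ := 1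
@[simp] abbrev arrCapA : ℕ := 0
@[simp] abbrev arrCapB : ℕ := 1
/-- The multiplicities of the pairs, and finally the output. -/
@[simp] abbrev arrX : ℕ := 2
@[simp] abbrev arrPos : ℕ := 3
@[simp] abbrev arrSide : ℕ := 4
/-- The capacities of all vertices. -/
@[simp] abbrev arrCap : ℕ := 5
/-- The target degrees. -/
@[simp] abbrev arrDeg : ℕ := 6
@[simp] abbrev arrPar : ℕ := 7
/-- The indicator of the alternating tree. -/
@[simp] abbrev arrTree : ℕ := 8
@[simp] abbrev arrCost : ℕ := 0
/-- The real array with the potential. -/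
@[simp] abbrev arrY : ℕ := 1

/-- The test `e₁ < e₂`. -/
def BExp.ilt (e₁ e₂ : IExp) : BExp := .not (.ile e₂ e₁)

/-- The test `e₁ = e₂`. -/
def BExp.ieq (e₁ e₂ : IExp) : BExp := .and (.ile e₁ e₂) (.ile e₂ e₁)

theorem BExp.holds_ilt {σ : State} {e₁ e₂ : IExp} :
    (BExp.ilt e₁ e₂).Holds σ ↔ e₁.eval σ < e₂.eval σ := not_le

theorem BExp.holds_ieq {σ : State} {e₁ e₂ : IExp} :
    (BExp.ieq e₁ e₂).Holds σ ↔ e₁.eval σ = e₂.eval σ := (le_antisymm_iff (α := ℕ)).symm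

/-- The vertices `e₁` and `e₂` are on the same side. -/
def sameSide (e₁ e₂ : IExp) : BExp := .ieq (.get arrSide e₁) (.get arrSide e₂)

/-- The position of the pair `e₁, e₂` in the arrays indexed by pairs. -/
def pairPos (e₁ e₂ : IExp) : IExp := .add (.get arrPos e₁) (.get arrPos e₂)

/-- The test whether the vertex `e` is in the tree. -/
def inTree (e : IExp) : BExp := .ile (.const 1) (.get arrTree e)

/-- Run `body` for the values `0, …, b - 1` of the counter, where `b` is the value of the
register `bound`. -/
def forTo (bound : ℕ) (body : Cmd) : Cmd :=
  .seq (.iset regI (.const 0))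
    (.loop (.ilt (.var regI) (.var bound))
      (.seq body (.iset regI (.add (.var regI) (.const 1)))))

theorem Run.forTo {bound : ℕ} {body : Cmd} {σ : State} {b : ℕ} {P : ℕ → State → Prop}
    (h₀ : P 0 (σ.iset regI 0)) (hi : ∀ i ρ, P i ρ → ρ.ivar regI = i ∧ ρ.ivar bound = b)
    (hstep : ∀ i < b, ∀ ρ, P i ρ →
      body.wp (fun τ => P (i + 1) (τ.iset regI (τ.ivar regI + 1))) ρ) :
    Run (RealRAM.forTo bound body) σ ((b + 1) * (body.time + 13)) (P b) := by
  refine Run.mono (Run.seq (K₁ := 2) (Run.of_wp (Q := P 0) h₀)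
    fun ρ hρ => Run.loop (P := fun m ρ => m ≤ b ∧ P (b - m) ρ) (K := body.time + 5) (Q := P b)
      ?_ ?_ b ρ ⟨le_rfl, by simpa using hρ⟩) ?_ fun _ => id
  · rintro m τ ⟨hm, hP⟩ hb
    rw [BExp.holds_ilt] at hb
    have := hi _ _ hP
    simp only [IExp.eval, this] at hb
    refine ⟨m - 1, by omega, Run.mono (Run.of_wp ?_) le_rfl fun _ => id⟩
    have := hstep (b - m) hb τ hP
    rw [show b - (m - 1) = b - m + 1 by omega]
    refine cast (congrArg (fun Q => body.wp Q τ) ?_) this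
    funext ρ
    simp only [Cmd.wp, IExp.eval]
    exact propext ⟨fun h => ⟨by omega, h⟩, fun h => h.2⟩
  · rintro m τ ⟨hm, hP⟩ hb
    rw [BExp.holds_ilt] at hb
    have := hi _ _ hP
    simp only [IExp.eval, this] at hb
    rwa [show b = b - m by omega]
  · simp only [BExp.ilt, BExp.cost, IExp.cost]
    nlinarith

/-- The contents of the memory during the search: the network, the potential `y`, the multiset `x`
of pairs, the target degrees, the parents and the tree, and the control registers. -/
structure Mem (N : Net) (pairs flag r best done : ℕ) (y : ℕ → ℝ) (x d par T : ℕ → ℕ)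
    (σ : State) : Prop where
  size : σ.ivar regSize = N.size
  pairs : σ.ivar regPairs = pairs
  flag : σ.ivar regFlag = flag
  root : σ.ivar regRoot = r
  best : σ.ivar regBest = best
  done : σ.ivar regDone = done
  pos : σ.iarr arrPos = N.pos
  side : σ.iarr arrSide = N.side
  cap : σ.iarr arrCap = N.cap
  cost : σ.rarr arrCost = N.cost
  y : σ.rarr arrY = y
  x : σ.iarr arrX = x
  d : σ.iarr arrDeg = d
  par : σ.iarr arrPar = par
  T : σ.iarr arrTree = T

theorem mem_iff {N : Net} {pairs flag r best done : ℕ} {y : ℕ → ℝ} {x d par T : ℕ → ℕ}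
    {σ : State} :
    Mem N pairs flag r best done y x d par T σ ↔
      (σ.ivar regSize = N.size ∧ σ.ivar regPairs = pairs ∧ σ.ivar regFlag = flag ∧
      σ.ivar regRoot = r ∧ σ.ivar regBest = best ∧ σ.ivar regDone = done) ∧
      (σ.iarr arrPos = N.pos ∧ σ.iarr arrSide = N.side ∧ σ.iarr arrCap = N.cap ∧
      σ.rarr arrCost = N.cost) ∧ σ.rarr arrY = y ∧ σ.iarr arrX = x ∧ σ.iarr arrDeg = d ∧
      σ.iarr arrPar = par ∧ σ.iarr arrTree = T :=
  ⟨fun h => ⟨⟨h.1, h.2, h.3, h.4, h.5, h.6⟩, ⟨h.7, h.8, h.9, h.10⟩, h.11, h.12, h.13, h.14, h.15⟩,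
    fun ⟨⟨h1, h2, h3, h4, h5, h6⟩, ⟨h7, h8, h9, h10⟩, h11, h12, h13, h14, h15⟩ =>
      ⟨h1, h2, h3, h4, h5, h6, h7, h8, h9, h10, h11, h12, h13, h14, h15⟩⟩

/-- The array `f` after its first `i` entries have been replaced by those of `g`. -/
def upto {α : Type} (i : ℕ) (g f : ℕ → α) (v : ℕ) : α := if v < i then g v else f v

theorem upto_zero {α : Type} (g f : ℕ → α) : upto 0 g f = f := by
  ext v; simp [upto]

theorem upto_of_lt {α : Type} {i v : ℕ} (g f : ℕ → α) (h : v < i) : upto i g f v = g v := if_pos h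

theorem upto_self {α : Type} (i : ℕ) (g f : ℕ → α) : upto i g f i = f i := if_neg (lt_irrefl i)

theorem update_upto {α : Type} {i : ℕ} {g f : ℕ → α} {a : α} (h : a = g i) :
    Function.update (upto i g f) i a = upto (i + 1) g f := by
  ext v
  rw [Function.update_apply]
  unfold upto
  split_ifs with h1 h2 h2
  · rw [h1, h]
  · omega
  · rfl
  · omega
  · omega
  · rfl

theorem upto_succ {α : Type} {i : ℕ} {g f : ℕ → α} (h : f i = g i) :
    upto i g f = upto (i + 1) g f := by
  rw [← update_upto (a := f i) h, ← upto_self i g f, Function.update_eq_self]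

section Eval

attribute [local simp] Cmd.wp IExp.eval RExp.eval BExp.Holds BExp.holds_ilt BExp.holds_ieq sameSide
  pairPos inTree State.iset State.rset State.istore State.rstore

/-- The body of the loop that starts the tree at the root. -/
def startBody : Cmd :=
  .seq (.cond (sameSide (.var regI) (.var regRoot))
      (.istore arrPar (.var regI) (.var regSize)) (.istore arrPar (.var regI) (.var regRoot)))
    (.cond (.ieq (.var regI) (.var regRoot))
      (.istore arrTree (.var regI) (.const 1)) (.istore arrTree (.var regI) (.const 0)))

variable {N : Net} {pairs flag r best done : ℕ} {y : ℕ → ℝ} {x d par T : ℕ → ℕ} {σ : State}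

theorem run_start (h : Mem N pairs flag r best done y x d par T σ) :
    Run (forTo regSize startBody) σ ((N.size + 1) * (startBody.time + 13)) fun τ =>
      Mem N pairs flag r best done y x d
        (upto N.size (fun v => if N.side v = N.side r then N.size else r) par)
        (upto N.size (fun v => if v = r then 1 else 0) T) τ := by
  refine Run.mono (Run.forTo (b := N.size) (P := fun i ρ => ρ.ivar regI = i ∧
    Mem N pairs flag r best done y x d
        (upto i (fun v => if N.side v = N.side r then N.size else r) par)
        (upto i (fun v => if v = r then 1 else 0) T) ρ) ?_ ?_ ?_) le_rfl
        fun _ hτ => hτ.2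
  · rw [mem_iff] at h
    simp at h
    simp [upto_zero, mem_iff, h]
  · exact fun i ρ hρ => ⟨hρ.1, hρ.2.size⟩
  · rintro i hib ρ ⟨hi, hM⟩
    rw [mem_iff] at hM
    simp at hi hM
    simp +contextual [startBody, mem_iff, hi, hM, update_upto]
    exact fun hs hr => absurd (congrArg N.side hr) hs

/-- The body of the loop that changes the potential in the tree. -/
def shiftBody : Cmd :=
  .cond (inTree (.var regI))
    (.cond (sameSide (.var regI) (.var regRoot))
      (.rstore arrY (.var regI) (.add (.get arrY (.var regI)) (.var regDelta)))
      (.rstore arrY (.var regI) (.sub (.get arrY (.var regI)) (.var regDelta))))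
    .nop

theorem run_shift (h : Mem N pairs flag r best done y x d par T σ) :
    Run (forTo regSize shiftBody) σ ((N.size + 1) * (shiftBody.time + 13)) fun τ =>
      Mem N pairs flag r best done (upto N.size (N.shift r T (σ.rvar regDelta) y) y) x d par T
        τ := by
  refine Run.mono (Run.forTo (b := N.size) (P := fun i ρ => (ρ.ivar regI = i ∧
    ρ.rvar regDelta = σ.rvar regDelta) ∧ Mem N pairs flag r best done
      (upto i (N.shift r T (σ.rvar regDelta) y) y) x d par T ρ) ?_ ?_ ?_) le_rfl
        fun _ hτ => hτ.2
  · rw [mem_iff] at h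
    simp at h
    simp [upto_zero, mem_iff, h]
  · exact fun i ρ hρ => ⟨hρ.1.1, hρ.2.size⟩
  · rintro i hib ρ ⟨⟨hi, hδ⟩, hM⟩
    rw [mem_iff] at hM
    simp at hi hM hδ
    simp [shiftBody, mem_iff, hi, hM, hδ, upto_self]
    refine ⟨fun hT => ⟨fun hs => update_upto ?_, fun hs => update_upto ?_⟩, fun hT => upto_succ ?_⟩
    · simp [Net.shift, Nat.one_le_iff_ne_zero, Nat.pos_iff_ne_zero.1 hT, hs]
    · simp [Net.shift, Nat.one_le_iff_ne_zero, Nat.pos_iff_ne_zero.1 hT, hs]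
    · simp [Net.shift, hT]

/-- The body of the loop that updates the parents after a vertex has joined the tree. -/
def scanBody : Cmd :=
  .cond (.and (.not (inTree (.var regI))) (.not (sameSide (.var regI) (.var regBest))))
    (.cond (sameSide (.var regBest) (.var regRoot))
      (.cond (.rle
          (.sub (.get arrCost (pairPos (.var regBest) (.var regI))) (.get arrY (.var regBest)))
          (.sub (.get arrCost (pairPos (.get arrPar (.var regI)) (.var regI)))
            (.get arrY (.get arrPar (.var regI)))))
        (.istore arrPar (.var regI) (.var regBest)) .nop)
      (.cond (.ile (.const 1) (.get arrX (pairPos (.var regBest) (.var regI))))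
        (.istore arrPar (.var regI) (.var regBest)) .nop))
    .nop

theorem run_scan (h : Mem N pairs flag r best done y x d par T σ) :
    Run (forTo regSize scanBody) σ ((N.size + 1) * (scanBody.time + 13)) fun τ =>
      Mem N pairs flag r best done y x d (upto N.size (N.scan r y x par T best) par) T τ := by
  refine Run.mono (Run.forTo (b := N.size) (P := fun i ρ => ρ.ivar regI = i ∧
    Mem N pairs flag r best done y x d (upto i (N.scan r y x par T best) par) T ρ)
      ?_ ?_ ?_) le_rfl fun _ hτ => hτ.2
  · rw [mem_iff] at h
    simp at h
    simp [upto_zero, mem_iff, h]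
  · exact fun i ρ hρ => ⟨hρ.1, hρ.2.size⟩
  · rintro i hib ρ ⟨hi, hM⟩
    rw [mem_iff] at hM
    simp at hi hM
    simp [scanBody, mem_iff, hi, hM, upto_self]
    refine ⟨fun hT hs => ⟨fun hb => ⟨fun hc => update_upto ?_, fun hc => upto_succ ?_⟩,
      fun hb => ⟨fun hx => update_upto ?_, fun hx => upto_succ ?_⟩⟩, fun hT => upto_succ ?_⟩
    · simp [Net.scan, hT, hb ▸ hs, hb, hc]
    · simp [Net.scan, hb, hc]
    · simp [Net.scan, hT, hs, hb, hx]
    · simp [Net.scan, hb, hx]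
    · by_cases h0 : T i = 0
      · simp [Net.scan, hT h0]
      · simp [Net.scan, h0]

/-- The body of the loop that finds the first event. -/
def findBody : Cmd :=
  .seq (.iset regEvent (.const 0))
    (.seq
      (.cond (inTree (.var regI))
        (.cond (sameSide (.var regI) (.var regRoot))
          (.cond (.ile (.const 2) (.get arrDeg (.var regI)))
            (.seq (.iset regEvent (.const 1))
              (.rset regVal (.sub .zero (.get arrY (.var regI))))) .nop)
          (.cond (.ilt (.get arrDeg (.var regI)) (.get arrCap (.var regI)))
            (.seq (.iset regEvent (.const 1)) (.rset regVal (.get arrY (.var regI)))) .nop))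
        (.cond (.ilt (.get arrPar (.var regI)) (.var regSize))
          (.seq (.iset regEvent (.const 1))
            (.rset regVal (.sub (.sub
              (.get arrCost (pairPos (.get arrPar (.var regI)) (.var regI)))
              (.get arrY (.get arrPar (.var regI)))) (.get arrY (.var regI))))) .nop))
      (.cond (.ile (.const 1) (.var regEvent))
        (.cond (.and (.ilt (.var regBest) (.var regSize)) (.rle (.var regDelta) (.var regVal)))
          .nop (.seq (.iset regBest (.var regI)) (.rset regDelta (.var regVal))))
        .nop))

/-- Among the first `i` vertices, `best` is one with the first event, at time `δ`, or there are no
events and `best` is the size of the network. -/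
def FirstEvent (N : Net) (r : ℕ) (y : ℕ → ℝ) (d par T : ℕ → ℕ) (i best : ℕ) (δ : ℝ) : Prop :=
  best = N.size ∧ (∀ v < i, ¬ N.IsEvent r d par T v) ∨
    best < N.size ∧ N.IsEvent r d par T best ∧ δ = N.eventTime r y par T best ∧
      ∀ v < i, N.IsEvent r d par T v → δ ≤ N.eventTime r y par T v

theorem FirstEvent.skip {i : ℕ} {δ : ℝ} (h : FirstEvent N r y d par T i best δ)
    (hi : N.IsEvent r d par T i → best < N.size ∧ δ ≤ N.eventTime r y par T i) :
    FirstEvent N r y d par T (i + 1) best δ := by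
  rcases h with ⟨h1, h2⟩ | ⟨h1, h2, h3, h4⟩
  · refine .inl ⟨h1, fun v hv => ?_⟩
    rcases Nat.lt_succ_iff_lt_or_eq.1 hv with hv | rfl
    · exact h2 v hv
    · exact fun he => absurd (hi he).1 (by omega)
  · refine .inr ⟨h1, h2, h3, fun v hv he => ?_⟩
    rcases Nat.lt_succ_iff_lt_or_eq.1 hv with hv | rfl
    · exact h4 v hv he
    · exact (hi he).2

theorem FirstEvent.take {i : ℕ} {δ δ' : ℝ} (h : FirstEvent N r y d par T i best δ)
    (hi : i < N.size) (he : N.IsEvent r d par T i) (hδ' : δ' = N.eventTime r y par T i)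
    (hle : best < N.size → δ' < δ) : FirstEvent N r y d par T (i + 1) i δ' := by
  refine .inr ⟨hi, he, hδ', fun v hv hev => ?_⟩
  rcases Nat.lt_succ_iff_lt_or_eq.1 hv with hv | rfl
  · rcases h with ⟨h1, h2⟩ | ⟨h1, h2, h3, h4⟩
    · exact absurd hev (h2 v hv)
    · exact (hle h1).le.trans (h4 v hv hev)
  · exact hδ'.le

theorem run_find (h : Mem N pairs flag r N.size done y x d par T σ) :
    Run (forTo regSize findBody) σ ((N.size + 1) * (findBody.time + 13)) fun τ =>
      ∃ best, Mem N pairs flag r best done y x d par T τ ∧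
        FirstEvent N r y d par T N.size best (τ.rvar regDelta) := by
  refine Run.mono (Run.forTo (b := N.size) (P := fun i ρ => ρ.ivar regI = i ∧
    ∃ best, Mem N pairs flag r best done y x d par T ρ ∧
        FirstEvent N r y d par T i best (ρ.rvar regDelta))
      ?_ ?_ ?_) le_rfl fun _ hτ => hτ.2
  · rw [mem_iff] at h
    simp at h
    exact ⟨by simp, N.size, by simp [mem_iff, h], .inl ⟨rfl, by simp⟩⟩
  · rintro i ρ ⟨h1, b, h2, -⟩
    exact ⟨h1, h2.size⟩
  · rintro i hib ρ ⟨hi, best, hM, hF⟩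
    rw [mem_iff] at hM
    simp at hi hM hF
    by_cases he : N.IsEvent r d par T i
    · by_cases hb : best < N.size ∧ ρ.rvar 0 ≤ N.eventTime r y par T i
      · have hF' := hF.skip fun _ => hb
        unfold Net.IsEvent at he
        unfold Net.eventTime at hb
        simp only [findBody]
        split_ifs at he hb with hT hs <;>
          simp [mem_iff, *]
      · have hF' := hF.take hib he rfl fun h => lt_of_not_ge fun h' => hb ⟨h, h'⟩
        unfold Net.IsEvent at he
        unfold Net.eventTime at hb hF'
        simp only [findBody]
        split_ifs at he hb hF' with hT hs <;>
          simp [mem_iff, *]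
    · have hF' := hF.skip fun h => absurd h he
      unfold Net.IsEvent at he
      simp only [findBody]
      split_ifs at he with hT hs <;>
        simp [mem_iff, *]

/-- One step of the search: find the first event, change the potential up to this event, and,
unless the event ends the search, let its vertex join the tree. -/
def stepCmd : Cmd :=
  .seq (.iset regBest (.var regSize)) (.seq (forTo regSize findBody)
    (.cond (.ile (.var regSize) (.var regBest))
      (.seq (.iset regFlag (.const 0)) (.iset regDone (.const 1)))
      (.seq (forTo regSize shiftBody)
        (.cond (inTree (.var regBest)) (.iset regDone (.const 1))
          (.seq (.istore arrTree (.var regBest) (.const 1)) (forTo regSize scanBody))))))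

/-- A bound, up to the factor `N.size + 1`, for the time of a step of the search. -/
def stepTime : ℕ := findBody.time + shiftBody.time + scanBody.time + 100

/-- The possible states of the search with at most `m` more steps: it goes on with fewer than `m`
vertices outside the tree, or it has ended because there is no solution, or it has ended with an
event in the tree. -/
def SearchState (N : Net) (pairs r : ℕ) (x d : ℕ → ℕ) (m : ℕ) (σ : State) : Prop :=
  ∃ flag best done y par T, Mem N pairs flag r best done y x d par T σ ∧
    (done = 0 ∧ flag = 1 ∧ N.Search r y x d par T ∧
        N.size - #{u ∈ range N.size | 1 ≤ T u} + 1 ≤ m ∨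
      done = 1 ∧ flag = 0 ∧ (∀ x', ¬ N.Feasible x') ∨
      done = 1 ∧ flag = 1 ∧ N.Search r y x d par T ∧ best < N.size ∧ 1 ≤ T best ∧
        N.IsEvent r d par T best ∧ N.eventTime r y par T best = 0)

theorem run_step (hN : N.Proper) (hs : N.Search r y x d par T)
    (h : Mem N pairs 1 r best 0 y x d par T σ) {m : ℕ}
    (hm : N.size - #{u ∈ range N.size | 1 ≤ T u} + 1 ≤ m) :
    Run stepCmd σ ((N.size + 1) * stepTime) (SearchState N pairs r x d (m - 1)) := by
  have hpre : Mem N pairs 1 r N.size 0 y x d par T (σ.iset regBest N.size) := by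
    rw [mem_iff] at h
    simp at h
    simp [mem_iff, h]
  refine Run.mono (Run.seq (K₁ := 2) (Q₁ := Mem N pairs 1 r N.size 0 y x d par T)
    (Run.of_wp (by simpa [h.size] using hpre)) fun ρ hρ => Run.seq (run_find hρ) fun τ hτ => ?_)
    (K := 2 + (((N.size + 1) * (findBody.time + 13)) + (3 + (5 + ((N.size + 1) *
      (shiftBody.time + 13) + (4 + (2 + (3 + (N.size + 1) * (scanBody.time + 13) + 1)) + 1) + 1)) +
      1) + 1) + 1) ?_ fun _ => id
  swap
  · unfold stepTime
    generalize findBody.time = a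
    generalize shiftBody.time = b
    generalize scanBody.time = c
    nlinarith
  obtain ⟨best, hM, hF⟩ := hτ
  refine Run.cond (fun hb => ?_) (fun hb => ?_)
  · -- there is no event
    simp only [BExp.Holds, IExp.eval, hM.size, hM.best] at hb
    refine Run.of_wp (c := .seq (.iset regFlag (.const 0)) (.iset regDone (.const 1))) ?_
    rcases hF with ⟨rfl, hno⟩ | ⟨hlt, -⟩
    · have hM' := hM
      rw [mem_iff] at hM'
      simp at hM'
      refine ⟨0, N.size, 1, y, par, T, ?_, .inr (.inl ⟨rfl, rfl, hs.not_feasible hN hno⟩)⟩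
      simp [mem_iff, hM']
    · omega
  simp only [BExp.Holds, IExp.eval, hM.size, hM.best, not_le] at hb
  obtain ⟨-, he, hδ, hmin⟩ : _ ∧ _ := hF.resolve_left fun h => by omega
  refine Run.seq (run_shift hM) fun ρ' hM' => ?_
  rw [hδ] at hM' hmin
  have hy : ∀ v < N.size, upto N.size (N.shift r T (N.eventTime r y par T best) y) y v =
      N.shift r T (N.eventTime r y par T best) y v := fun v hv => upto_of_lt _ _ hv
  have hs' : N.Search r (upto N.size (N.shift r T (N.eventTime r y par T best) y) y) x d par T :=
    (hs.shift hN (hs.eventTime_nonneg hb he) hmin).congr hy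
  have h0 := hs'.eventTime_shift hb he hy
  generalize upto N.size (N.shift r T (N.eventTime r y par T best) y) y = y' at hM' hs' h0
  refine Run.cond (fun hT => ?_) (fun hT => ?_)
  · -- the event ends the search
    simp only [inTree, BExp.Holds, IExp.eval, hM'.T, hM'.best] at hT
    refine Run.of_wp (c := .iset regDone (.const 1)) ?_
    refine ⟨1, best, 1, y', par, T, ?_, .inr (.inr ⟨rfl, rfl, hs', hb, hT, he, h0⟩)⟩
    rw [mem_iff] at hM'
    simp at hM'
    simp [mem_iff, hM']
  · -- the vertex of the event joins the tree
    simp only [inTree, BExp.Holds, IExp.eval, hM'.T, hM'.best] at hT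
    refine Run.seq (Q₁ := Mem N pairs 1 r best 0 y' x d par (Function.update T best 1))
      (Run.of_wp ?_) fun ρ'' hM'' => Run.mono (run_scan hM'') le_rfl fun τ' hτ' => ?_
    · rw [mem_iff] at hM'
      simp at hM'
      simp [mem_iff, hM']
    · rw [Net.IsEvent, if_neg hT] at he
      obtain ⟨h1, h2⟩ := hs'.insert hN hb hT he h0 rfl fun v hv => upto_of_lt
        (N.scan r y' x par (Function.update T best 1) best) par hv
      refine ⟨1, best, 0, y', _, _, hτ', .inl ⟨rfl, rfl, h1, ?_⟩⟩
      have : #{u ∈ range N.size | 1 ≤ Function.update T best 1 u} ≤ N.size :=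
        (card_filter_le _ _).trans (card_range _).le
      omega

/-- Search for an augmenting path, or for the reason why there is no solution. -/
def searchLoop : Cmd := .loop (.not (.ile (.const 1) (.var regDone))) stepCmd

theorem run_search (hN : N.Proper) (hs : N.Search r y x d par T)
    (h : Mem N pairs 1 r best 0 y x d par T σ) :
    Run searchLoop σ ((N.size + 1) * ((N.size + 1) * (stepTime + 5))) fun τ =>
      SearchState N pairs r x d 0 τ := by
  have h1 : 0 < #{u ∈ range N.size | 1 ≤ T u} :=
    card_pos.2 ⟨r, mem_filter.2 ⟨mem_range.2 hs.root_lt, hs.root_mem⟩⟩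
  refine Run.mono (Run.loop (P := SearchState N pairs r x d) (K := (N.size + 1) * stepTime) ?_ ?_
    N.size σ ⟨1, best, 0, y, par, T, h, .inl ⟨rfl, rfl, hs, ?_⟩⟩) ?_ fun _ => id
  · rintro m τ ⟨flag, best, done, y, par, T, hM, hst⟩ hb
    simp only [BExp.Holds, IExp.eval, hM.done] at hb
    rcases hst with ⟨rfl, rfl, hs, hm⟩ | ⟨rfl, -⟩ | ⟨rfl, -⟩
    · exact ⟨m - 1, by omega, run_step hN hs hM hm⟩
    · exact absurd le_rfl hb
    · exact absurd le_rfl hb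
  · rintro m τ ⟨flag, best, done, y, par, T, hM, hst⟩ hb
    simp only [BExp.Holds, IExp.eval, hM.done, not_not] at hb
    refine ⟨flag, best, done, y, par, T, hM, hst.imp_left ?_⟩
    rintro ⟨rfl, -⟩
    omega
  · have := hs.root_lt
    omega
  · refine Nat.mul_le_mul_left _ ?_
    simp only [BExp.cost, IExp.cost]
    nlinarith

/-- Flip the tree path from the vertex of the last event to the root. -/
def flipCmd : Cmd :=
  .seq (.cond (sameSide (.var regBest) (.var regRoot))
      (.istore arrDeg (.var regBest) (.sub (.get arrDeg (.var regBest)) (.const 1)))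
      (.istore arrDeg (.var regBest) (.add (.get arrDeg (.var regBest)) (.const 1))))
    (.seq (.iset regP (.var regBest))
      (.loop (.not (.ieq (.var regP) (.var regRoot)))
        (.seq (.iset regQ (pairPos (.get arrPar (.var regP)) (.var regP)))
          (.seq (.cond (sameSide (.var regP) (.var regRoot))
              (.istore arrX (.var regQ) (.sub (.get arrX (.var regQ)) (.const 1)))
              (.istore arrX (.var regQ) (.add (.get arrX (.var regQ)) (.const 1))))
            (.iset regP (.get arrPar (.var regP)))))))

theorem run_flip (hN : N.Proper) (hs : N.Search r y x d par T) (hb : best < N.size)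
    (hT : 1 ≤ T best) (he : N.IsEvent r d par T best) (h0 : N.eventTime r y par T best = 0)
    (h : Mem N pairs 1 r best 1 y x d par T σ) :
    Run flipCmd σ ((N.size + 1) * 100) fun τ => ∃ x' d',
      Mem N pairs 1 r best 1 y x' d' par T τ ∧ N.Certified y x' d' ∧
        (∀ v < N.size, N.deg x' v = d' v) ∧ ∀ v ≤ r, 1 ≤ d' v := by
  obtain ⟨⟨rank, mem, hf, hrank⟩, hone⟩ := hs.flip hb hT he h0 rfl
  set d' := Function.update d best (if N.side best = N.side r then d best - 1 else d best + 1)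
    with hd'
  refine Run.mono (Run.seq (K₁ := 40) (Q₁ := Mem N pairs 1 r best 1 y x d' par T)
    (Run.mono (Run.of_wp ?_) (by decide) fun _ => id) fun ρ hρ => Run.seq (K₁ := 2)
    (Q₁ := fun τ => τ.ivar regP = best ∧ Mem N pairs 1 r best 1 y x d' par T τ) (Run.of_wp ?_)
    fun ρ' hρ' => Run.loop (K := 50) (P := fun m τ => ∃ p x',
      (τ.ivar regP = p ∧ rank p ≤ m ∧ N.Flip r y x' d' par rank mem p) ∧
        Mem N pairs 1 r best 1 y x' d' par T τ) ?_ ?_ N.size ρ'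
        ⟨best, x, ⟨hρ'.1, hrank.le, hf⟩, hρ'.2⟩) ?_ fun _ => id
  · rw [mem_iff] at h
    simp at h
    simp [mem_iff, h]
    exact ⟨fun hs => by simp [hd', hs], fun hs => by simp [hd', hs]⟩
  · rw [mem_iff] at hρ
    simp at hρ
    simp [mem_iff, hρ]
  · rintro m τ ⟨p, x', ⟨hp, hm, hf⟩, hM⟩ hpr
    rw [BExp.Holds, BExp.holds_ieq] at hpr
    simp only [IExp.eval, hp, hM.root] at hpr
    obtain ⟨hf', hlt⟩ := hf.step hN hpr
    refine ⟨m - 1, by omega, Run.mono (Run.of_wp ?_) (by decide) fun _ => id⟩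
    have hm' : rank (par p) ≤ m - 1 := by omega
    rw [mem_iff] at hM
    simp at hM hp
    simp [mem_iff, hM, hp]
    exact ⟨fun hs => ⟨hm', by simpa [hs] using hf'⟩, fun hs => ⟨hm', by simpa [hs] using hf'⟩⟩
  · rintro m τ ⟨p, x', ⟨hp, hm, hf⟩, hM⟩ hpr
    rw [BExp.Holds, BExp.holds_ieq, not_not] at hpr
    simp only [IExp.eval, hp, hM.root] at hpr
    subst hpr
    exact ⟨x', d', hM, hf.toCertified, hf.deg_root, hone⟩
  · simp only [BExp.cost, BExp.ieq, IExp.cost]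
    omega

end Eval
end RealRAM

/-! ### Assignments as multisets of pairs -/

namespace LCAInstance

/-- The network has the vertices `0, …, s - 1` for the set `A` and `s, …, s + t - 1` for the set
`B`, and its pairs are stored as in the input. -/
structure Encodes (I : LCAInstance) (N : Net) : Prop where
  size : N.size = I.s + I.t
  pos_left : ∀ i < I.s, N.pos i = i * I.t
  pos_right : ∀ j < I.t, N.pos (I.s + j) = j
  side_left : ∀ i < I.s, N.side i = 0
  side_right : ∀ j < I.t, N.side (I.s + j) = 1
  cap_left : ∀ i : Fin I.s, N.cap i = I.capA i
  cap_right : ∀ j : Fin I.t, N.cap (I.s + j) = I.capB j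
  cost : ∀ (i : Fin I.s) (j : Fin I.t), N.cost (i * I.t + j) = I.cost i j

variable {I : LCAInstance} {N : Net} {x : ℕ → ℕ}

theorem pairPos_inj {i j i' j' t : ℕ} (hj : j < t) (hj' : j' < t)
    (h : i * t + j = i' * t + j') : i = i' ∧ j = j' := by
  have h1 := congrArg (· / t) h
  have h2 := congrArg (· % t) h
  simp only [mul_comm _ t, Nat.mul_add_div (by omega : 0 < t), Nat.div_eq_of_lt hj,
    Nat.div_eq_of_lt hj', Nat.mul_add_mod, Nat.mod_eq_of_lt hj, Nat.mod_eq_of_lt hj', add_zero]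
    at h1 h2
  exact ⟨h1, h2⟩

theorem pairPos_lt {i j s t : ℕ} (hi : i < s) (hj : j < t) : i * t + j < s * t := by
  have : (i + 1) * t ≤ s * t := Nat.mul_le_mul_right _ hi
  nlinarith

theorem Encodes.vertex (h : I.Encodes N) {v : ℕ} (hv : v < N.size) :
    v < I.s ∨ ∃ j < I.t, v = I.s + j := by
  rw [h.size] at hv
  by_cases hs : v < I.s
  · exact .inl hs
  · exact .inr ⟨v - I.s, by omega, by omega⟩

/-- A pair of vertices on different sides consists of an element of `A` and an element of `B`. -/
theorem Encodes.pair (h : I.Encodes N) {u v : ℕ} (hu : u < N.size) (hv : v < N.size)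
    (hs : N.side u ≠ N.side v) : ∃ i < I.s, ∃ j < I.t, N.pos u + N.pos v = i * I.t + j ∧
      (u = i ∧ v = I.s + j ∨ u = I.s + j ∧ v = i) := by
  rcases h.vertex hu with h1 | ⟨j, hj, rfl⟩ <;> rcases h.vertex hv with h2 | ⟨j', hj', rfl⟩
  · rw [h.side_left u h1, h.side_left v h2] at hs; exact absurd rfl hs
  · exact ⟨u, h1, j', hj', by rw [h.pos_left u h1, h.pos_right j' hj'], .inl ⟨rfl, rfl⟩⟩
  · exact ⟨v, h2, j, hj, by rw [h.pos_left v h2, h.pos_right j hj, add_comm], .inr ⟨rfl, rfl⟩⟩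
  · rw [h.side_right j hj, h.side_right j' hj'] at hs; exact absurd rfl hs

theorem Encodes.proper (h : I.Encodes N) : N.Proper where
  side_le v hv := by
    rcases h.vertex hv with h1 | ⟨j, hj, rfl⟩
    · rw [h.side_left v h1]; exact Nat.zero_le _
    · rw [h.side_right j hj]
  pos_inj u hu v hv u' hu' v' hv' hs hs' he := by
    obtain ⟨i, hi, j, hj, h1, h2⟩ := h.pair hu hv hs
    obtain ⟨i', hi', j', hj', h1', h2'⟩ := h.pair hu' hv' hs'
    rw [h1, h1'] at he
    obtain ⟨rfl, rfl⟩ := pairPos_inj hj hj' he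
    omega

theorem Encodes.deg_left (h : I.Encodes N) (x : ℕ → ℕ) (i : Fin I.s) :
    N.deg x i = ∑ j : Fin I.t, x (i * I.t + j) := by
  rw [Net.deg, h.size, sum_range_add, sum_eq_zero, zero_add, sum_range]
  · refine sum_congr rfl fun j _ => ?_
    rw [h.side_left i i.2, h.side_right j j.2, if_pos one_ne_zero, h.pos_left i i.2,
      h.pos_right j j.2, add_comm]
  · intro u hu
    rw [mem_range] at hu
    rw [h.side_left i i.2, h.side_left u hu, if_neg (fun hh => hh rfl)]

theorem Encodes.deg_right (h : I.Encodes N) (x : ℕ → ℕ) (j : Fin I.t) :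
    N.deg x (I.s + j) = ∑ i : Fin I.s, x (i * I.t + j) := by
  rw [Net.deg, h.size, sum_range_add, add_comm, sum_eq_zero, zero_add, sum_range]
  · refine sum_congr rfl fun i _ => ?_
    rw [h.side_left i i.2, h.side_right j j.2, if_pos zero_ne_one, h.pos_left i i.2,
      h.pos_right j j.2]
  · intro u hu
    rw [mem_range] at hu
    rw [h.side_right j j.2, h.side_right u hu, if_neg (fun hh => hh rfl)]

theorem Encodes.twiceCost (h : I.Encodes N) (x : ℕ → ℕ) :
    N.twiceCost x = 2 * ∑ i : Fin I.s, ∑ j : Fin I.t, (x (i * I.t + j) : ℝ) * I.cost i j := by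
  have hA : ∀ i : Fin I.s, (∑ v ∈ range N.size, if N.side i ≠ N.side v then
      (x (N.pos i + N.pos v) : ℝ) * N.cost (N.pos i + N.pos v) else 0) =
      ∑ j : Fin I.t, (x (i * I.t + j) : ℝ) * I.cost i j := by
    intro i
    rw [h.size, sum_range_add, sum_eq_zero, zero_add, sum_range]
    · refine sum_congr rfl fun j _ => ?_
      rw [h.side_left i i.2, h.side_right j j.2, if_pos zero_ne_one, h.pos_left i i.2,
        h.pos_right j j.2, h.cost]
    · intro u hu
      rw [mem_range] at hu
      rw [h.side_left i i.2, h.side_left u hu, if_neg (fun hh => hh rfl)]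
  have hB : ∀ j : Fin I.t, (∑ v ∈ range N.size, if N.side (I.s + j) ≠ N.side v then
      (x (N.pos (I.s + j) + N.pos v) : ℝ) * N.cost (N.pos (I.s + j) + N.pos v) else 0) =
      ∑ i : Fin I.s, (x (i * I.t + j) : ℝ) * I.cost i j := by
    intro j
    rw [h.size, sum_range_add, add_comm, sum_eq_zero, zero_add, sum_range]
    · refine sum_congr rfl fun i _ => ?_
      rw [h.side_left i i.2, h.side_right j j.2, if_pos one_ne_zero, h.pos_left i i.2,
        h.pos_right j j.2, add_comm (j : ℕ), h.cost]
    · intro u hu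
      rw [mem_range] at hu
      rw [h.side_right j j.2, h.side_right u hu, if_neg (fun hh => hh rfl)]
  rw [Net.twiceCost]
  nth_rewrite 1 [h.size]
  rw [sum_range_add, sum_range, sum_range, sum_congr rfl fun i _ => hA i,
    sum_congr rfl fun j _ => hB j, sum_comm (s := (univ : Finset (Fin I.t)))]
  ring

/-- `x` is the indicator function of the set `M` of pairs. -/
def Indicates (I : LCAInstance) (x : ℕ → ℕ) (M : Finset (Fin I.s × Fin I.t)) : Prop :=
  ∀ i j, x (i.1 * I.t + j.1) = if (i, j) ∈ M then 1 else 0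

theorem exists_indicates (M : Finset (Fin I.s × Fin I.t)) : ∃ x, I.Indicates x M := by
  classical
  refine ⟨fun q => if ∃ p ∈ M, p.1.1 * I.t + p.2.1 = q then 1 else 0, fun i j => ?_⟩
  refine if_congr ⟨?_, fun h => ⟨(i, j), h, rfl⟩⟩ rfl rfl
  rintro ⟨⟨i', j'⟩, hp, he⟩
  obtain ⟨h1, h2⟩ := pairPos_inj j'.2 j.2 he
  rwa [← Fin.ext h1, ← Fin.ext h2]

variable {M : Finset (Fin I.s × Fin I.t)}

theorem Indicates.sum_left (hx : I.Indicates x M) (i : Fin I.s) :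
    ∑ j : Fin I.t, x (i * I.t + j) = #{p ∈ M | p.1 = i} := by
  simp only [hx i]
  rw [← card_filter]
  refine card_bij (fun j _ => (i, j)) ?_ ?_ ?_
  · simp
  · simp
  · rintro ⟨i', j⟩ h
    simp only [mem_filter] at h
    exact ⟨j, by simpa [h.2] using h.1, by rw [h.2]⟩

theorem Indicates.sum_right (hx : I.Indicates x M) (j : Fin I.t) :
    ∑ i : Fin I.s, x (i * I.t + j) = #{p ∈ M | p.2 = j} := by
  simp only [fun i => hx i j]
  rw [← card_filter]
  refine card_bij (fun i _ => (i, j)) ?_ ?_ ?_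
  · simp
  · simp
  · rintro ⟨i, j'⟩ h
    simp only [mem_filter] at h
    exact ⟨i, by simpa [h.2] using h.1, by rw [h.2]⟩

theorem Encodes.feasible_iff (h : I.Encodes N) (hx : I.Indicates x M) :
    N.Feasible x ↔ I.IsAssignment M := by
  unfold IsAssignment IsGeneralizedAssignment
  simp only [← hx.sum_left, ← hx.sum_right, ← h.deg_left, ← h.deg_right, ← h.cap_left,
    ← h.cap_right]
  constructor
  · exact fun hf => ⟨fun i => hf i (by rw [h.size]; omega), fun j => hf _ (by rw [h.size]; omega)⟩
  · rintro ⟨h1, h2⟩ v hv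
    rcases h.vertex hv with hs | ⟨j, hj, rfl⟩
    · exact h1 ⟨v, hs⟩
    · exact h2 ⟨j, hj⟩

theorem Encodes.twiceCost_eq (h : I.Encodes N) (hx : I.Indicates x M) :
    N.twiceCost x = 2 * I.totalCost M := by
  rw [h.twiceCost, totalCost, ← Fintype.sum_prod_type' (f := fun (i : Fin I.s) (j : Fin I.t) =>
    (x (i * I.t + j) : ℝ) * I.cost i j), ← sum_filter_add_sum_filter_not univ (· ∈ M)]
  rw [sum_eq_zero (s := {p | p ∉ M}), add_zero, filter_mem_eq_inter, univ_inter]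
  · refine congrArg _ (sum_congr rfl fun p hp => ?_)
    rw [hx p.1 p.2, if_pos hp, Nat.cast_one, one_mul]
  · intro p hp
    rw [hx p.1 p.2, if_neg (mem_filter.1 hp).2, Nat.cast_zero, zero_mul]

end LCAInstance

/-! ### The main program -/

namespace RealRAM

section Main

attribute [local simp] Cmd.wp IExp.eval RExp.eval BExp.Holds BExp.holds_ilt BExp.holds_ieq sameSide
  pairPos inTree State.iset State.rset State.istore State.rstore

/-- Raise the degree of the root from `0` to `1`, or prove that there is no solution. -/
def phaseCmd : Cmd :=
  .seq (.seq (.istore arrDeg (.var regRoot) (.const 1)) (.iset regDone (.const 0)))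
    (.seq (forTo regSize startBody)
      (.seq searchLoop (.cond (.ile (.const 1) (.var regFlag)) flipCmd .nop)))

/-- The state before the vertex `r` is treated: all vertices before `r` have a positive degree and
the degrees are realized by a certified multiset, or there is no solution. -/
def PhaseState (N : Net) (pairs reg r : ℕ) (σ : State) : Prop :=
  ∃ flag best done y x d par T, Mem N pairs flag reg best done y x d par T σ ∧
    (flag = 1 ∧ N.Certified y x d ∧ (∀ v < N.size, N.deg x v = d v) ∧ (∀ v < r, 1 ≤ d v) ∨
      flag = 0 ∧ ∀ x', ¬ N.Feasible x')

variable {N : Net} {pairs r best done : ℕ} {y : ℕ → ℝ} {x d par T : ℕ → ℕ} {σ : State}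

/-- A bound, up to the factor `(N.size + 1) ^ 2`, for the time of a phase. -/
def phaseTime : ℕ := startBody.time + stepTime + 200

theorem run_phase (hN : N.Proper) (hc : N.Certified y x d)
    (hdeg : ∀ v < N.size, N.deg x v = d v) (hr : r < N.size) (hd : d r = 0) (hcap : 1 ≤ N.cap r)
    (hpos : ∀ v < r, 1 ≤ d v) (h : Mem N pairs 1 r best done y x d par T σ) :
    Run phaseCmd σ ((N.size + 1) * ((N.size + 1) * phaseTime)) (PhaseState N pairs r (r + 1)) := by
  refine Run.mono (Run.seq (K₁ := 10)
    (Q₁ := Mem N pairs 1 r best 0 y x (Function.update d r 1) par T)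
    (Run.mono (Run.of_wp ?_) (by decide) fun _ => id) fun ρ hρ => Run.seq (run_start hρ)
    fun τ hτ => Run.seq (run_search hN (hc.search
      (T := upto N.size (fun v => if v = r then 1 else 0) T)
      (par := upto N.size (fun v => if N.side v = N.side r then N.size else r) par)
      hdeg hr hd hcap hpos rfl (fun v hv => upto_of_lt _ _ hv) (fun v hv => upto_of_lt _ _ hv)) hτ)
    (K₂ := 3 + ((N.size + 1) * 100 + 1) + 1) fun ρ' hρ' => ?_) ?_ fun _ => id
  · rw [mem_iff] at h
    simp at h
    simp [mem_iff, h]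
  · obtain ⟨flag, best, done, y, par, T, hM, hst⟩ := hρ'
    refine Run.cond (fun hb => ?_) (fun hb => ?_)
    · simp only [BExp.Holds, IExp.eval, hM.flag] at hb
      rcases hst with ⟨-, -, -, hm⟩ | ⟨-, rfl, -⟩ | ⟨rfl, rfl, hs, hlt, hT, he, h0⟩
      · omega
      · omega
      · refine Run.mono (run_flip hN hs hlt hT he h0 hM) le_rfl ?_
        rintro τ' ⟨x', d', hM', hc', hdeg', hone⟩
        exact ⟨1, best, 1, y, x', d', par, T, hM', .inl ⟨rfl, hc', hdeg', fun v hv =>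
          hone v (Nat.lt_succ_iff.1 hv)⟩⟩
    · simp only [BExp.Holds, IExp.eval, hM.flag] at hb
      refine Run.of_wp (c := .nop) ⟨flag, best, done, y, _, _, par, T, hM, .inr ?_⟩
      rcases hst with ⟨-, -, -, hm⟩ | ⟨-, rfl, hno⟩ | ⟨rfl, rfl, -⟩
      · omega
      · exact ⟨rfl, hno⟩
      · omega
  · unfold phaseTime
    generalize startBody.time = a
    generalize stepTime = b
    nlinarith [Nat.zero_le (N.size * a), Nat.zero_le (N.size * N.size * a),
      Nat.zero_le (N.size * N.size)]

/-- Treat all vertices. -/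
def mainLoop : Cmd :=
  .loop (.and (.ilt (.var regRoot) (.var regSize)) (.ile (.const 1) (.var regFlag)))
    (.seq
      (.cond (.ieq (.get arrDeg (.var regRoot)) (.const 0))
        (.cond (.ieq (.get arrCap (.var regRoot)) (.const 0))
          (.iset regFlag (.const 0)) phaseCmd)
        .nop)
      (.iset regRoot (.add (.var regRoot) (.const 1))))

theorem run_main (hN : N.Proper) (hc : N.Certified y x d) (hdeg : ∀ v < N.size, N.deg x v = d v)
    (h : Mem N pairs 1 0 best done y x d par T σ) :
    Run mainLoop σ ((N.size + 1) * ((N.size + 1) * ((N.size + 1) * (phaseTime + 50))))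
      fun τ => ∃ reg, PhaseState N pairs reg N.size τ := by
  refine Run.mono (Run.loop (K := (N.size + 1) * ((N.size + 1) * phaseTime) + 30)
    (P := fun m τ => ∃ r, r + m = N.size ∧ PhaseState N pairs r r τ) ?_ ?_ N.size σ
    ⟨0, by omega, 1, best, done, y, x, d, par, T, h, .inl ⟨rfl, hc, hdeg, by simp⟩⟩) ?_ fun _ => id
  · rintro m τ ⟨r, hm, flag, best, done, y, x, d, par, T, hM, hst⟩ hb
    simp only [BExp.Holds, BExp.holds_ilt, IExp.eval, hM.root, hM.size, hM.flag] at hb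
    obtain ⟨rfl, hc, hdeg, hpos⟩ := hst.resolve_right fun h => by omega
    refine ⟨m - 1, by omega, Run.mono (Run.seq (Q₁ := PhaseState N pairs r (r + 1)) (K₂ := 4)
      (Run.cond (K₁ := 9 + (2 + (N.size + 1) * ((N.size + 1) * phaseTime)) + 1) (K₂ := 1)
        (fun h0 => ?_) fun h0 => ?_) fun ρ hρ => Run.of_wp ?_) ?_ fun _ => id⟩
    · simp only [BExp.holds_ieq, IExp.eval, hM.root, hM.d] at h0
      refine Run.mono (Run.cond (K₁ := 2) (fun hz => ?_) fun hz =>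
        run_phase hN hc hdeg hb.1 h0 ?_ hpos hM) ?_ fun _ => id
      · simp only [BExp.holds_ieq, IExp.eval, hM.root, hM.cap] at hz
        refine Run.of_wp (c := .iset regFlag (.const 0))
          ⟨0, best, done, y, x, d, par, T, ?_, .inr ⟨rfl, fun x' hx' => ?_⟩⟩
        · rw [mem_iff] at hM
          simp at hM
          simp [mem_iff, hM]
        · have := hx' r hb.1
          omega
      · simp only [BExp.holds_ieq, IExp.eval, hM.root, hM.cap] at hz
        omega
      · simp only [BExp.cost, BExp.ieq, IExp.cost]
        omega
    · simp only [BExp.holds_ieq, IExp.eval, hM.root, hM.d] at h0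
      refine Run.of_wp (c := .nop) ⟨1, best, done, y, x, d, par, T, hM, .inl
        ⟨rfl, hc, hdeg, fun v hv => ?_⟩⟩
      rcases Nat.lt_succ_iff_lt_or_eq.1 hv with hv | rfl
      · exact hpos v hv
      · omega
    · obtain ⟨flag, best, done, y, x, d, par, T, hM, hst⟩ := hρ
      refine ⟨r + 1, by omega, flag, best, done, y, x, d, par, T, ?_, hst⟩
      rw [mem_iff] at hM
      simp at hM
      simp [mem_iff, hM]
    · simp only [BExp.cost, BExp.ieq, IExp.cost]
      omega
  · rintro m τ ⟨r, hm, flag, best, done, y, x, d, par, T, hM, hst⟩ hb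
    simp only [BExp.Holds, BExp.holds_ilt, IExp.eval, hM.root, hM.size, hM.flag] at hb
    refine ⟨r, flag, best, done, y, x, d, par, T, hM, hst.imp_left ?_⟩
    rintro ⟨rfl, hc, hdeg, hpos⟩
    have : r = N.size := by omega
    exact ⟨rfl, hc, hdeg, this ▸ hpos⟩
  · refine Nat.mul_le_mul_left _ ?_
    simp only [BExp.cost, BExp.ilt, IExp.cost]
    generalize phaseTime = a
    nlinarith [Nat.zero_le (N.size * N.size), Nat.zero_le N.size]

/-- The body of the loop that truncates the multiplicities. -/
def truncateBody : Cmd :=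
  .cond (.ile (.const 1) (.get arrX (.var regI))) (.istore arrX (.var regI) (.const 1)) .nop

theorem run_truncate {flag : ℕ} (h : Mem N pairs flag r best done y x d par T σ) :
    Run (forTo regPairs truncateBody) σ ((pairs + 1) * (truncateBody.time + 13)) fun τ =>
      Mem N pairs flag r best done y (upto pairs (fun q => min 1 (x q)) x) d par T τ := by
  refine Run.mono (Run.forTo (b := pairs) (P := fun i ρ => ρ.ivar regI = i ∧
    Mem N pairs flag r best done y (upto i (fun q => min 1 (x q)) x) d par T ρ)
      ?_ ?_ ?_) le_rfl fun _ hτ => hτ.2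
  · rw [mem_iff] at h
    simp at h
    simp [upto_zero, mem_iff, h]
  · exact fun i ρ hρ => ⟨hρ.1, hρ.2.pairs⟩
  · rintro i hib ρ ⟨hi, hM⟩
    rw [mem_iff] at hM
    simp at hi hM
    simp [truncateBody, mem_iff, hi, hM, upto_self]
    exact ⟨fun hx => update_upto (by omega), fun hx => upto_succ (by omega)⟩

/-- The body of the loop that sets up the network with zero potential and zero degrees.  The
register `regPairs` grows to `s * t` and provides the multiples of `t`. -/
def initBody : Cmd :=
  .seq (.cond (.ilt (.var regI) (.var regS))
      (.seq (.istore arrPos (.var regI) (.var regPairs))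
        (.seq (.istore arrSide (.var regI) (.const 0))
          (.seq (.istore arrCap (.var regI) (.get arrCapA (.var regI)))
            (.iset regPairs (.add (.var regPairs) (.var regT))))))
      (.seq (.istore arrPos (.var regI) (.sub (.var regI) (.var regS)))
        (.seq (.istore arrSide (.var regI) (.const 1))
          (.istore arrCap (.var regI) (.get arrCapB (.sub (.var regI) (.var regS)))))))
    (.seq (.istore arrDeg (.var regI) (.const 0)) (.rstore arrY (.var regI) .zero))

/-- The network that the program builds from the input in the state `σ`.  Array entries for
numbers that are not vertices keep their old values. -/
def inputNet (σ : State) (s t : ℕ) : Net where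
  size := s + t
  pos := upto (s + t) (fun v => if v < s then v * t else v - s) (σ.iarr arrPos)
  side := upto (s + t) (fun v => if v < s then 0 else 1) (σ.iarr arrSide)
  cap := upto (s + t) (fun v => if v < s then σ.iarr arrCapA v else σ.iarr arrCapB (v - s))
    (σ.iarr arrCap)
  cost := σ.rarr arrCost

/-- Set up the network, and set all multiplicities to `0`. -/
def initCmd : Cmd :=
  .seq (.seq (.iset regSize (.add (.var regS) (.var regT))) (.iset regPairs (.const 0)))
    (.seq (forTo regSize initBody)
      (.seq (.seq (.iset regFlag (.const 1)) (.iset regRoot (.const 0)))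
        (forTo regPairs (.istore arrX (.var regI) (.const 0)))))

theorem run_init {s t : ℕ} (hs : σ.ivar regS = s) (ht : σ.ivar regT = t) :
    Run initCmd σ (7 + ((s + t + 1) * (initBody.time + 13) + (5 + (s * t + 1) * 16 + 1) + 1) + 1)
      fun τ => ∃ best done y x d par T,
        Mem (inputNet σ s t) (s * t) 1 0 best done y x d par T τ ∧
          (∀ v < s + t, y v = 0 ∧ d v = 0) ∧ ∀ q < s * t, x q = 0 := by
  refine Run.seq (Q₁ := fun ρ => (ρ.ivar regS = s ∧ ρ.ivar regT = t ∧ ρ.ivar regSize = s + t ∧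
    ρ.ivar regPairs = 0) ∧ ρ.iarr = σ.iarr ∧ ρ.rarr = σ.rarr) (Run.of_wp ?_) fun ρ hρ => Run.seq
      (Run.forTo (b := s + t) (P := fun i ρ => (ρ.ivar regI = i ∧ ρ.ivar regS = s ∧
        ρ.ivar regT = t ∧ ρ.ivar regSize = s + t ∧ ρ.ivar regPairs = min i s * t) ∧
        (ρ.iarr arrCapA = σ.iarr arrCapA ∧ ρ.iarr arrCapB = σ.iarr arrCapB ∧
          ρ.rarr arrCost = σ.rarr arrCost) ∧
        ρ.iarr arrPos = upto i (fun v => if v < s then v * t else v - s) (σ.iarr arrPos) ∧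
        ρ.iarr arrSide = upto i (fun v => if v < s then 0 else 1) (σ.iarr arrSide) ∧
        ρ.iarr arrCap = upto i (fun v => if v < s then σ.iarr arrCapA v
          else σ.iarr arrCapB (v - s)) (σ.iarr arrCap) ∧
        ρ.iarr arrDeg = upto i (fun _ => 0) (σ.iarr arrDeg) ∧
        ρ.rarr arrY = upto i (fun _ => 0) (σ.rarr arrY)) ?_ ?_ ?_)
      fun τ hτ => ?_
  · simp at hs ht
    simp [hs, ht]
  · simp at hρ
    simp [hρ, upto_zero]
  · rintro i ρ ⟨⟨h1, -, -, h2, -⟩, -⟩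
    exact ⟨h1, h2⟩
  · rintro i hib ρ ⟨⟨h1, h2, h3, h4, h5⟩, ⟨h6, h7, h8⟩, h9, h10, h11, h12, h13⟩
    simp at h1 h2 h3 h4 h5 h6 h7 h8 h9 h10 h11 h12 h13
    simp [initBody, *]
    refine ⟨fun hlt => ⟨?_, update_upto (by simp [hlt, hlt.le]), update_upto (by simp [hlt]),
      update_upto (by simp [hlt]), update_upto rfl, update_upto rfl⟩, fun hle => ⟨?_,
      update_upto (by simp [hle.not_gt]), update_upto (by simp [hle.not_gt]),
      update_upto (by simp [hle.not_gt]), update_upto rfl, update_upto rfl⟩⟩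
    · rw [min_eq_left hlt.le, min_eq_left hlt, add_mul, one_mul]
    · left; omega
  · obtain ⟨⟨h1, h2, h3, h4, h5⟩, ⟨h6, h7, h8⟩, h9, h10, h11, h12, h13⟩ := hτ
    have hmem : ∀ best done x par T, τ.ivar regBest = best → τ.ivar regDone = done →
        τ.iarr arrX = x → τ.iarr arrPar = par → τ.iarr arrTree = T →
        Mem (inputNet σ s t) (s * t) 1 0 best done (τ.rarr arrY) x (τ.iarr arrDeg) par T
          ((τ.iset regFlag 1).iset regRoot 0) := by
      intro best done x par T e1 e2 e3 e4 e5
      rw [min_eq_right (Nat.le_add_right s t)] at h5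
      simp at h1 h2 h3 h4 h5 h6 h7 h8 h9 h10 h11 h12 h13 e1 e2 e3 e4 e5
      simp [mem_iff, inputNet, *]
    refine Run.seq (Run.of_wp (hmem _ _ _ _ _ rfl rfl rfl rfl rfl)) fun ρ' hM => Run.mono
      (Run.forTo (b := s * t) (P := fun i ρ => ρ.ivar regI = i ∧
        Mem (inputNet σ s t) (s * t) 1 0 (τ.ivar regBest) (τ.ivar regDone) (τ.rarr arrY)
          (upto i (fun _ => 0) (τ.iarr arrX)) (τ.iarr arrDeg) (τ.iarr arrPar) (τ.iarr arrTree) ρ)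
        ?_ ?_ ?_) ?_ fun ρ'' hρ'' => ⟨_, _, _, _, _, _, _, hρ''.2, ?_,
          fun q hq => upto_of_lt _ _ hq⟩
    · rw [mem_iff] at hM
      simp at hM
      simp [upto_zero, mem_iff, hM]
    · exact fun i ρ hρ => ⟨hρ.1, hρ.2.pairs⟩
    · rintro i hib ρ ⟨hi, hM⟩
      rw [mem_iff] at hM
      simp at hi hM
      simp [mem_iff, hi, hM, update_upto]
    · simp [Cmd.time, IExp.cost]
    · intro v hv
      rw [h12, h13]
      exact ⟨upto_of_lt _ _ hv, upto_of_lt _ _ hv⟩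

end Main
end RealRAM

/-! ### Correctness of the whole program -/

namespace RealRAM

variable {I : LCAInstance} {σ : State}

theorem encodes_inputNet (h : I.IsInput σ) : I.Encodes (inputNet σ I.s I.t) where
  size := rfl
  pos_left i hi := by simp [inputNet, upto, hi, Nat.lt_add_right I.t hi]
  pos_right j hj := by simp [inputNet, upto, hj]
  side_left i hi := by simp [inputNet, upto, hi, Nat.lt_add_right I.t hi]
  side_right j hj := by simp [inputNet, upto, hj]
  cap_left i := by simp [inputNet, upto, Nat.lt_add_right I.t i.2, h.2.2.1 i]
  cap_right j := by simp [inputNet, upto, h.2.2.2.1 j]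
  cost := h.2.2.2.2

/-- With nonnegative costs, the potential `0` certifies the empty multiset. -/
theorem certified_zero {N : Net} (hN : I.Encodes N) (hcost : ∀ i j, 0 ≤ I.cost i j)
    {y : ℕ → ℝ} {x d : ℕ → ℕ} (hy : ∀ v < I.s + I.t, y v = 0 ∧ d v = 0)
    (hx : ∀ q < I.s * I.t, x q = 0) :
    N.Certified y x d ∧ ∀ v < N.size, N.deg x v = d v := by
  rw [← hN.size] at hy
  have hx' : ∀ u < N.size, ∀ v < N.size, N.side u ≠ N.side v → x (N.pos u + N.pos v) = 0 := by
    intro u hu v hv hs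
    obtain ⟨i, hi, j, hj, he, -⟩ := hN.pair hu hv hs
    rw [he]
    exact hx _ (LCAInstance.pairPos_lt hi hj)
  refine ⟨⟨fun u hu v hv hs => ?_, fun u hu v hv hs h1 => ?_, fun v hv _ => (hy v hv).1.ge,
    fun v hv _ => (hy v hv).1.le, fun v hv => (hy v hv).2.le.trans (Nat.zero_le _)⟩,
    fun v hv => ?_⟩
  · obtain ⟨i, hi, j, hj, he, -⟩ := hN.pair hu hv hs
    rw [(hy u hu).1, (hy v hv).1, add_zero, he]
    exact (hcost ⟨i, hi⟩ ⟨j, hj⟩).trans (hN.cost ⟨i, hi⟩ ⟨j, hj⟩).ge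
  · rw [hx' u hu v hv hs] at h1
    omega
  · rw [(hy v hv).2]
    refine sum_eq_zero fun u hu => ?_
    split_ifs with hs
    · exact hx' u (mem_range.1 hu) v hv hs
    · rfl

/-- A certified multiset with positive degrees yields, after truncation, an optimal assignment. -/
theorem isMinCostAssignment_output {N : Net} (hN : I.Encodes N) (hcost : ∀ i j, 0 ≤ I.cost i j)
    {y : ℕ → ℝ} {x d : ℕ → ℕ} (hc : N.Certified y x d) (hdeg : ∀ v < N.size, N.deg x v = d v)
    (hpos : ∀ v < N.size, 1 ≤ d v) {τ : State}
    (hτ : ∀ q < I.s * I.t, τ.iarr arrX q = min 1 (x q)) : I.IsMinCostAssignment (I.output τ) := by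
  have hx₁ : ∀ u < N.size, ∀ v < N.size, N.side u ≠ N.side v →
      τ.iarr arrX (N.pos u + N.pos v) = min 1 (x (N.pos u + N.pos v)) := by
    intro u hu v hv hs
    obtain ⟨i, hi, j, hj, he, -⟩ := hN.pair hu hv hs
    rw [he]
    exact hτ _ (LCAInstance.pairPos_lt hi hj)
  have hind : I.Indicates (τ.iarr arrX) (I.output τ) := by
    intro i j
    have := hτ _ (LCAInstance.pairPos_lt i.2 j.2)
    simp only [LCAInstance.output, mem_filter, mem_univ, true_and]
    split_ifs with h
    · exact h
    · simp only [arrX] at this h ⊢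
      omega
  have hf : N.Feasible x := fun v hv => by
    rw [hdeg v hv]
    exact ⟨hpos v hv, hc.le_cap v hv⟩
  refine ⟨(hN.feasible_iff hind).1 (hf.truncate hx₁), fun M' hM' => ?_⟩
  obtain ⟨x', hx'⟩ := LCAInstance.exists_indicates M'
  have h1 := hc.optimal hdeg ((hN.feasible_iff hx').2 hM')
  have h2 := Net.twiceCost_truncate (N := N) (x := x) (fun u hu v hv hs => by
    obtain ⟨i, hi, j, hj, he, -⟩ := hN.pair hu hv hs
    rw [he]
    exact (hcost ⟨i, hi⟩ ⟨j, hj⟩).trans (hN.cost ⟨i, hi⟩ ⟨j, hj⟩).ge) hx₁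
  rw [hN.twiceCost_eq hind] at h2
  rw [hN.twiceCost_eq hx'] at h1
  linarith

/-- The whole program. -/
def assignCmd : Cmd := .seq initCmd (.seq mainLoop (forTo regPairs truncateBody))

/-- The constant in the bound for the running time of the program. -/
def assignTime : ℕ := initBody.time + phaseTime + truncateBody.time + 200

theorem run_assign (hcost : ∀ i j, 0 ≤ I.cost i j) (h : I.IsInput σ) :
    Run assignCmd σ ((I.s + I.t + 1) ^ 3 * assignTime) fun τ =>
      ((∃ M, I.IsAssignment M) → τ.ivar regFlag = 1 ∧ I.IsMinCostAssignment (I.output τ)) ∧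
      ((¬ ∃ M, I.IsAssignment M) → τ.ivar regFlag = 0) := by
  have hN := encodes_inputNet h
  refine Run.mono (Run.seq (run_init h.1 h.2.1) fun ρ hρ => ?_)
    (K := (7 + ((I.s + I.t + 1) * (initBody.time + 13) + (5 + (I.s * I.t + 1) * 16 + 1) + 1) + 1) +
      ((I.s + I.t + 1) * ((I.s + I.t + 1) * ((I.s + I.t + 1) * (phaseTime + 50))) +
        (I.s * I.t + 1) * (truncateBody.time + 13) + 1) + 1) ?_ fun _ => id
  · obtain ⟨best, done, y, x, d, par, T, hM, hy, hx⟩ := hρ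
    obtain ⟨hc, hdeg⟩ := certified_zero hN hcost hy hx
    refine Run.seq (run_main hN.proper hc hdeg hM) ?_
    rintro ρ' ⟨reg, flag, best, done, y, x, d, par, T, hM', hst⟩
    refine Run.mono (run_truncate hM') le_rfl fun τ hτ => ?_
    rcases hst with ⟨rfl, hc', hdeg', hpos⟩ | ⟨rfl, hno⟩
    · have hmin := isMinCostAssignment_output hN hcost hc' hdeg' hpos (τ := τ) fun q hq => by
        rw [hτ.x]
        exact upto_of_lt _ _ hq
      exact ⟨fun _ => ⟨hτ.flag, hmin⟩, fun hne => absurd ⟨_, hmin.1⟩ hne⟩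
    · refine ⟨fun ⟨M, hM⟩ => ?_, fun _ => hτ.flag⟩
      obtain ⟨x', hx'⟩ := LCAInstance.exists_indicates M
      exact absurd ((hN.feasible_iff hx').2 hM) (hno x')
  · unfold assignTime
    generalize initBody.time = a
    generalize phaseTime = b
    generalize truncateBody.time = c
    have h1 : I.s * I.t + 1 ≤ (I.s + I.t + 1) ^ 3 := by
      have : I.s * I.t + 1 ≤ (I.s + I.t + 1) ^ 2 := by nlinarith
      exact this.trans (Nat.pow_le_pow_right (by omega) (by omega))
    have h2 : I.s + I.t + 1 ≤ (I.s + I.t + 1) ^ 3 := Nat.le_self_pow (by omega) _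
    have h3 := Nat.mul_le_mul_right (c + 29) h1
    have h4 := Nat.mul_le_mul_right (a + 13) h2
    have h5 : (I.s + I.t + 1) * ((I.s + I.t + 1) * ((I.s + I.t + 1) * (b + 50))) =
        (I.s + I.t + 1) ^ 3 * (b + 50) := by ring
    rw [h5]
    generalize (I.s + I.t + 1) ^ 3 = m at *
    nlinarith

end RealRAM

theorem theorem3 :
    ∃ (P : RealRAM.Cmd) (C : ℕ), ∀ (I : LCAInstance) (σ : RealRAM.State),
      (∀ i j, 0 ≤ I.cost i j) → I.IsInput σ →
        ∃ (k : ℕ) (τ : RealRAM.State),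
          RealRAM.Exec P σ k τ ∧
          k ≤ C * ((I.s + I.t) ^ 3 + 1) ∧
          ((∃ M, I.IsAssignment M) → τ.ivar 2 = 1 ∧ I.IsMinCostAssignment (I.output τ)) ∧
          ((¬ ∃ M, I.IsAssignment M) → τ.ivar 2 = 0) := by
  refine ⟨RealRAM.assignCmd, 8 * RealRAM.assignTime, fun I σ hcost h => ?_⟩
  obtain ⟨k, τ, he, hk, hτ⟩ := RealRAM.run_assign hcost h
  refine ⟨k, τ, he, hk.trans ?_, hτ⟩
  have h1 : (I.s + I.t + 1) ^ 3 ≤ 8 * ((I.s + I.t) ^ 3 + 1) := by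
    generalize I.s + I.t = n
    rcases Nat.eq_zero_or_pos n with rfl | hn
    · norm_num
    · calc (n + 1) ^ 3 ≤ (2 * n) ^ 3 := Nat.pow_le_pow_left (by omega) 3
        _ ≤ 8 * (n ^ 3 + 1) := by ring_nf; omega
  calc (I.s + I.t + 1) ^ 3 * RealRAM.assignTime
      ≤ 8 * ((I.s + I.t) ^ 3 + 1) * RealRAM.assignTime := Nat.mul_le_mul_right _ h1
    _ = 8 * RealRAM.assignTime * ((I.s + I.t) ^ 3 + 1) := by ring
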